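/- Let $\mathbb{H}$ be a real Hilbert space with inner product $\langle\cdot,\cdot\rangle$ and norm $\|\cdot\|$, and let $A:D(A)\subset\mathbb{H}\to\mathbb{H}$ be a self-adjoint operator that has an orthonormal eigenbasis $\{\phi_n\}_{n\ge1}$ of $\mathbb{H}$ with eigenvalues $0<\lambda_1\le\lambda_2\le\dots$, $\lambda_n\to+\infty$. For $p>0$ put $D(A^p)=\{\psi\in\mathbb{H}:\sum_n\lambda_n^{2p}\langle\psi,\phi_n\rangle^2<\infty\}$ and $\|\psi\|_p=\big(\sum_n\lambda_n^{2p}\langle\psi,\phi_n\rangle^2\big)^{1/2}$ for $\psi\in D(A^p)$. Let $0<\gamma<1$, $T>0$, $b>1$, $\tau>1$, $p>0$. For $\alpha>0$ let $$B_\alpha v=(I+\alpha A^b)^{-1}v=\sum_{n\ge1}\frac{\langle v,\phi_n\rangle\phi_n}{1+\alpha\lambda_n^b},\qquad A_\alpha v=(I+\alpha A^b)^{-1}A\,v=\sum_{n\ge1}\frac{\lambda_n\langle v,\phi_n\rangle\phi_n}{1+\alpha\lambda_n^b},$$ where $A_\alpha$ is taken as the bounded operator on $\mathbb{H}$ given by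 the series. Let $\frac{\partial^\gamma u}{\partial t^\gamma}(t)=\frac1{\Gamma(1-\gamma)}\int_0^t(t-s)^{-\gamma}u'(s)\,ds$ be the Caputo derivative. For $L=A$ or $L=A_\alpha$, a solution of $\frac{\partial^\gamma u}{\partial t^\gamma}+Lu=0$ on $(0,T)$ is a function $u\in C^1((0,T),\mathbb{H})\cap C([0,T],\mathbb{H})$ with $u(t)\in D(L)$ for $0<t<T$, such that the integral in the Caputo derivative converges absolutely (as a Bochner integral) and the equation holds for every $t\in(0,T)$. There is a constant $C>0$ that depends only on $\gamma,T,b,\tau,p,\lambda_1$ such that for every $f\in\mathbb{H}$ and every $\varepsilon>0$ with $\tau\varepsilon<\|f\|$ the following holds. There is a unique $\alpha_\varepsilon>0$ with $$\|B_{\alpha_\varepsilon}f-f\|=\tau\varepsilon .$$ Moreover, let $u$ be a solution of $\frac{\partial^\gamma u}{\partial t^\gamma}+Au=0$ on $(0,T)$ with $\|u(T)-f\|\le\varepsilon$ and $u(0)\in D(A^p)$, and let $v_{\alpha_\varepsilon}$ be a solution of $\frac{\partial^\gamma v}{\partial t^\gamma}+A_{\alpha_\varepsilon}v=0$ on $(0,T)$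 with $v(T)=f$. Then (i) if $p<b-1$, $$\|u(0)-v_{\alpha_\varepsilon}(0)\|\le C\,\varepsilon^{\frac p{p+1}}\|u(0)\|_p^{\frac1{p+1}};$$ (ii) if $p\ge b-1$, $$\|u(0)-v_{\alpha_\varepsilon}(0)\|\le C\left(\varepsilon^{\frac p{p+1}}\|u(0)\|_p^{\frac1{p+1}}+\varepsilon^{\frac{b-1}b}\|u(0)\|_p^{\frac1b}\right).$$ -/

import Mathlib

open scoped InnerProductSpace

noncomputable section

namespace FractionalSobolev

variable {H : Type*} [NormedAddCommGroup H] [InnerProductSpace ℝ H]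

/-- The Caputo derivative of order `γ` at time `t` of a function with values in `H`. -/
def caputoDeriv (γ : ℝ) (u : ℝ → H) (t : ℝ) : H :=
  (Real.Gamma (1 - γ))⁻¹ • ∫ s in (0 : ℝ)..t, (t - s) ^ (-γ) • deriv u s

/-- `u` is a solution on `[0, T]` of `∂^γ u / ∂t^γ + L u = 0`, where `L` is a (possibly unbounded)
linear operator in `H`: `u ∈ C¹((0, T), H) ∩ C([0, T], H)`, `u t ∈ D(L)` for `0 < t < T`, the
Caputo derivative exists and the equation holds on `(0, T)`. -/
structure IsSolution (γ T : ℝ) (L : H →ₗ.[ℝ] H) (u : ℝ → H) : Prop where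
  contDiffOn : ContDiffOn ℝ 1 u (Set.Ioo 0 T)
  continuousOn : ContinuousOn u (Set.Icc 0 T)
  integrable : ∀ t ∈ Set.Ioo 0 T, IntervalIntegrable (fun s => (t - s) ^ (-γ) • deriv u s)
    MeasureTheory.volume 0 t
  equation : ∀ t ∈ Set.Ioo 0 T, ∃ ht : u t ∈ L.domain, caputoDeriv γ u t + L ⟨u t, ht⟩ = 0

/-- `A` is a self-adjoint operator with the orthonormal eigenbasis `φ` and the eigenvalues
`0 < lam 0 ≤ lam 1 ≤ …`, listed with multiplicity, that tend to infinity. -/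
structure IsEigenSystem [CompleteSpace H] (A : H →ₗ.[ℝ] H) (φ : HilbertBasis ℕ ℝ H)
    (lam : ℕ → ℝ) : Prop where
  selfAdjoint : IsSelfAdjoint A
  pos : 0 < lam 0
  mono : Monotone lam
  tendsto : Filter.Tendsto lam Filter.atTop Filter.atTop
  eigen : ∀ n, ∃ hn : φ n ∈ A.domain, A ⟨φ n, hn⟩ = lam n • φ n

/-- The series `∑ₙ cₙ ⟨v, φₙ⟩ φₙ`. -/
def spectralSum (φ : HilbertBasis ℕ ℝ H) (c : ℕ → ℝ) (v : H) : H :=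
  ∑' n, (c n * ⟪v, φ n⟫_ℝ) • φ n

theorem memLp_of_summable_sq {a : ℕ → ℝ} (ha : Summable fun n => a n ^ 2) : Memℓp a 2 := by
  refine memℓp_gen ?_
  simpa using ha

theorem hasSum_smul (φ : HilbertBasis ℕ ℝ H) {a : ℕ → ℝ} (ha : Summable fun n => a n ^ 2) :
    HasSum (fun n => a n • φ n) (φ.repr.symm ⟨a, memLp_of_summable_sq ha⟩) :=
  φ.hasSum_repr_symm ⟨a, memLp_of_summable_sq ha⟩

theorem summable_inner_sq (φ : HilbertBasis ℕ ℝ H) (v : H) :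
    Summable fun n => ⟪v, φ n⟫_ℝ ^ 2 := by
  refine (φ.summable_inner_mul_inner v v).congr fun n => ?_
  rw [real_inner_comm v (φ n), sq]

/-- The operator `v ↦ ∑ₙ cₙ ⟨v, φₙ⟩ φₙ` on its maximal domain
`{v : ∑ₙ cₙ² ⟨v, φₙ⟩² < ∞}`. -/
def spectralOp (φ : HilbertBasis ℕ ℝ H) (c : ℕ → ℝ) : H →ₗ.[ℝ] H where
  domain :=
    { carrier := {v | Summable fun n => (c n * ⟪v, φ n⟫_ℝ) ^ 2}
      zero_mem' := by simp [summable_zero]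
      add_mem' := by
        intro v w hv hw
        refine Summable.of_nonneg_of_le (fun n => sq_nonneg _) (fun n => ?_)
          ((hv.mul_left 2).add (hw.mul_left 2))
        rw [inner_add_left, mul_add]
        nlinarith [sq_nonneg (c n * ⟪v, φ n⟫_ℝ - c n * ⟪w, φ n⟫_ℝ)]
      smul_mem' := by
        intro r v hv
        refine (Summable.mul_left (r ^ 2) hv).congr fun n => ?_
        rw [real_inner_smul_left]
        ring }
  toFun :=
    { toFun := fun v => spectralSum φ c v
      map_add' := by
        intro v w
        have h := ((hasSum_smul φ v.2).summable).tsum_add (hasSum_smul φ w.2).summable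
        refine Eq.trans (tsum_congr fun n => ?_) h
        rw [Submodule.coe_add, inner_add_left, mul_add, add_smul]
      map_smul' := by
        intro r v
        have h := ((hasSum_smul φ v.2).summable).tsum_const_smul r
        refine Eq.trans (tsum_congr fun n => ?_) h
        rw [Submodule.coe_smul, real_inner_smul_left, smul_smul]
        congr 1
        ring }

/-- The power `A ^ b`, that is `A ^ b v = ∑ₙ λₙ ^ b ⟨v, φₙ⟩ φₙ`. -/
def powOp (φ : HilbertBasis ℕ ℝ H) (lam : ℕ → ℝ) (b : ℝ) : H →ₗ.[ℝ] H :=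
  spectralOp φ fun n => lam n ^ b

/-- `B_α = (I + α A ^ b)⁻¹`, that is `B_α v = ∑ₙ (1 + α λₙ ^ b)⁻¹ ⟨v, φₙ⟩ φₙ`, `v ∈ H`. -/
def resolventOp (φ : HilbertBasis ℕ ℝ H) (lam : ℕ → ℝ) (b α : ℝ) (v : H) : H :=
  spectralSum φ (fun n => 1 / (1 + α * lam n ^ b)) v

/-- `A_α = (I + α A ^ b)⁻¹ A`, that is `A_α v = ∑ₙ λₙ (1 + α λₙ ^ b)⁻¹ ⟨v, φₙ⟩ φₙ`. -/
def regularizedOp (φ : HilbertBasis ℕ ℝ H) (lam : ℕ → ℝ) (b α : ℝ) : H →ₗ.[ℝ] H :=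
  spectralOp φ fun n => lam n / (1 + α * lam n ^ b)

/-- `D(A ^ p)`, the vectors `ψ` with `∑ₙ λₙ ^ (2 p) ⟨ψ, φₙ⟩² < ∞`. -/
def powDomain (φ : HilbertBasis ℕ ℝ H) (lam : ℕ → ℝ) (p : ℝ) : Set H :=
  {ψ | Summable fun n => lam n ^ (2 * p) * ⟪ψ, φ n⟫_ℝ ^ 2}

/-- The norm `‖ψ‖_p = (∑ₙ λₙ ^ (2 p) ⟨ψ, φₙ⟩²) ^ (1 / 2)` on `D(A ^ p)`. -/
def powNorm (φ : HilbertBasis ℕ ℝ H) (lam : ℕ → ℝ) (p : ℝ) (ψ : H) : ℝ :=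
  Real.sqrt (∑' n, lam n ^ (2 * p) * ⟪ψ, φ n⟫_ℝ ^ 2)

theorem spectralSum_coeff (φ : HilbertBasis ℕ ℝ H) (c : ℕ → ℝ) (v : H)
    (h : Summable fun n => (c n * ⟪v, φ n⟫_ℝ) ^ 2) (n : ℕ) :
    ⟪spectralSum φ c v, φ n⟫_ℝ = c n * ⟪v, φ n⟫_ℝ := by
  have h1 := (hasSum_smul φ h).tsum_eq
  unfold spectralSum
  rw [h1, real_inner_comm, ← φ.repr_apply_apply]
  simp

theorem ext_coeff (φ : HilbertBasis ℕ ℝ H) {v w : H} (h : ∀ n, ⟪v, φ n⟫_ℝ = ⟪w, φ n⟫_ℝ) :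
    v = w := by
  apply φ.repr.injective
  ext n
  rw [φ.repr_apply_apply, φ.repr_apply_apply, real_inner_comm, h n, real_inner_comm]

theorem summable_of_bounded (φ : HilbertBasis ℕ ℝ H) (c : ℕ → ℝ) (K : ℝ) (hc : ∀ n, |c n| ≤ K)
    (v : H) : Summable fun n => (c n * ⟪v, φ n⟫_ℝ) ^ 2 := by
  refine Summable.of_nonneg_of_le (fun n => sq_nonneg _) (fun n => ?_)
    ((summable_inner_sq φ v).mul_left (K ^ 2))
  rw [mul_pow, ← sq_abs (c n)]
  have := hc n
  gcongr

variable {φ : HilbertBasis ℕ ℝ H} {lam : ℕ → ℝ} {b α : ℝ}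

/-- `B_α` is a right inverse of `I + α A ^ b`. -/
theorem resolventOp_spec (hlam : ∀ n, 0 < lam n) (hα : 0 < α) (f : H) :
    ∃ h : resolventOp φ lam b α f ∈ (powOp φ lam b).domain,
      resolventOp φ lam b α f + α • powOp φ lam b ⟨resolventOp φ lam b α f, h⟩ = f := by
  have hb : ∀ n, 0 < lam n ^ b := fun n => Real.rpow_pos_of_pos (hlam n) b
  have hB : Summable fun n => (1 / (1 + α * lam n ^ b) * ⟪f, φ n⟫_ℝ) ^ 2 := by
    refine summable_of_bounded φ _ 1 (fun n => ?_) f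
    have := mul_pos hα (hb n)
    rw [abs_of_pos (by positivity), div_le_one (by positivity)]
    linarith
  have hco := spectralSum_coeff φ _ f hB
  have hm : Summable fun n => (lam n ^ b * ⟪resolventOp φ lam b α f, φ n⟫_ℝ) ^ 2 := by
    unfold resolventOp
    simp only [hco, ← mul_assoc]
    refine summable_of_bounded φ _ (1 / α) (fun n => ?_) f
    have := mul_pos hα (hb n)
    have := hb n
    rw [abs_of_pos (by positivity), mul_one_div, div_le_div_iff₀ (by positivity) hα]
    nlinarith
  refine ⟨hm, ext_coeff φ fun n => ?_⟩
  have hco2 := spectralSum_coeff φ _ _ hm n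
  change ⟪_ + α • spectralSum φ _ _, _⟫_ℝ = _
  rw [inner_add_left, real_inner_smul_left, hco2]
  unfold resolventOp
  rw [hco n]
  have := mul_pos hα (hb n)
  field_simp

/-- `B_α` is a left inverse of `I + α A ^ b`. -/
theorem resolventOp_unique (hlam : ∀ n, 0 < lam n) (hα : 0 < α) (v : (powOp φ lam b).domain) :
    resolventOp φ lam b α (v + α • powOp φ lam b v) = v := by
  have hb : ∀ n, 0 < lam n ^ b := fun n => Real.rpow_pos_of_pos (hlam n) b
  refine ext_coeff φ fun n => ?_
  unfold resolventOp
  rw [spectralSum_coeff]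
  · have hco := spectralSum_coeff φ _ (v : H) v.2 n
    change _ * ⟪_ + α • spectralSum φ _ _, _⟫_ℝ = _
    rw [inner_add_left, real_inner_smul_left, hco]
    have := mul_pos hα (hb n)
    field_simp
  · refine summable_of_bounded φ _ 1 (fun n => ?_) _
    have := mul_pos hα (hb n)
    rw [abs_of_pos (by positivity), div_le_one (by positivity)]
    linarith

/-- `A_α` extends `B_α A` from `D(A)` (to all of `H` when `b ≥ 1`). -/
theorem regularizedOp_apply [CompleteSpace H] {A : H →ₗ.[ℝ] H} (hA : IsEigenSystem A φ lam)
    (hα : 0 < α) (v : A.domain) :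
    ∃ h : (v : H) ∈ (regularizedOp φ lam b α).domain,
      regularizedOp φ lam b α ⟨v, h⟩ = resolventOp φ lam b α (A v) := by
  have hb : ∀ n, 0 < lam n ^ b :=
    fun n => Real.rpow_pos_of_pos (hA.pos.trans_le (hA.mono (Nat.zero_le n))) b
  have hco : ∀ n, ⟪A v, φ n⟫_ℝ = lam n * ⟪(v : H), φ n⟫_ℝ := by
    intro n
    obtain ⟨hn, he⟩ := hA.eigen n
    have h := A.adjoint_isFormalAdjoint hA.selfAdjoint.dense_domain
    rw [LinearPMap.isSelfAdjoint_def.1 hA.selfAdjoint] at h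
    have h1 := h v ⟨φ n, hn⟩
    rw [he, real_inner_smul_right] at h1
    exact h1
  have hB : Summable fun n => (1 / (1 + α * lam n ^ b) * ⟪A v, φ n⟫_ℝ) ^ 2 := by
    refine summable_of_bounded φ _ 1 (fun n => ?_) _
    have := mul_pos hα (hb n)
    rw [abs_of_pos (by positivity), div_le_one (by positivity)]
    linarith
  have hm : Summable fun n => (lam n / (1 + α * lam n ^ b) * ⟪(v : H), φ n⟫_ℝ) ^ 2 := by
    refine hB.congr fun n => ?_
    rw [hco]
    ring
  refine ⟨hm, tsum_congr fun n => ?_⟩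
  rw [hco]
  congr 1
  ring

theorem regularizedOp_domain (hlam : ∀ n, lam 0 ≤ lam n) (h0 : 0 < lam 0) (hb : 1 ≤ b)
    (hα : 0 < α) : (regularizedOp φ lam b α).domain = ⊤ := by
  refine eq_top_iff.2 fun v _ => ?_
  refine summable_of_bounded φ _ (1 + 1 / α) (fun n => ?_) v
  have hl : 0 < lam n := h0.trans_le (hlam n)
  have hp : 0 < lam n ^ b := Real.rpow_pos_of_pos hl b
  have hle : lam n ≤ 1 + lam n ^ b := by
    rcases le_total (lam n) 1 with h | h
    · linarith
    · have := Real.rpow_le_rpow_of_exponent_le h hb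
      rw [Real.rpow_one] at this
      linarith
  have := mul_pos hα hp
  rw [abs_of_pos (by positivity), div_le_iff₀ (by positivity)]
  have h1 : 1 / α * (α * lam n ^ b) = lam n ^ b := by field_simp
  have h2 : 0 < 1 / α := by positivity
  nlinarith

end FractionalSobolev

end

/-!
The proof works mode by mode and never constructs the Mittag-Leffler function.

The coefficients `u n t = ⟪u t, φ n⟫` and `v n t = ⟪v t, φ n⟫` solve the scalar equation
`∂^γ w / ∂t^γ + L w = 0` with the rates `L = λ` and `L = μ`, where `λ = lam n` and
`μ = λ / (1 + α λ ^ b)` (`IsSolution.isModeSolution`). A comparison principle holds for this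
equation (`IsCaputoRegular.nonneg_of_supersolution`), since integration by parts makes the Caputo
derivative negative at a negative minimum. The explicit functions `(1 + c t ^ γ)⁻¹` with `c`
proportional to `L` are sub- and supersolutions. Comparison with them shows that `|w T|` is between
two multiples of `|w 0| / (1 + L)`, and that solutions with equal initial values and the rates
`μ ≤ λ` differ at time `T` by at most a multiple of `(1 - μ / λ) |w 0| / (1 + μ)`. Hence
`|u n 0 - v n 0| ≤ C (1 + μ) |v n T - u n T| + C θ |u n 0|`, where
`θ = 1 - μ / λ = α λ ^ b / (1 + α λ ^ b)` is the multiplier of the residual `I - B_α`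
(`IsModeSolution.abs_initial_sub_le`).

It remains to sum over the modes. As `μ ≤ α ^ (-1 / b)`, the first term contributes at most
`C (1 + α ^ (-1 / b)) ε`. By the choice of `α` the residual of `u T` is between `(τ - 1) ε` and
`(τ + 1) ε`. The lower bound, with the smoothing by one order from `u 0` to `u T`, bounds `α` from
below (`norm_residual_le_powNorm`); this is where the cases `p < b - 1` and `p ≥ b - 1` differ. The
upper bound controls the second term by interpolation with the `p`-norm
(`norm_residual_le_interpolation`). Existence and uniqueness of `α` follow since the residual of `f`
is continuous and strictly increasing in `α`, from `0` to `‖f‖`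
(`existsUnique_norm_resolventOp_sub_eq`).
-/

noncomputable section

namespace FractionalSobolev

open Set MeasureTheory

variable {γ T : ℝ} {H : Type*} [NormedAddCommGroup H] [InnerProductSpace ℝ H]

/-! ### The scalar Caputo derivative and its comparison principle -/

/-- The real functions whose Caputo derivative of order `γ` exists at every point of `(0, T)`:
continuous on `[0, T]`, differentiable on `(0, T)`, with an integrable Caputo integrand. -/
structure IsCaputoRegular (γ T : ℝ) (w : ℝ → ℝ) : Prop where
  continuousOn : ContinuousOn w (Icc 0 T)
  differentiableAt : ∀ t ∈ Ioo 0 T, DifferentiableAt ℝ w t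
  integrable : ∀ t ∈ Ioo 0 T, IntervalIntegrable (fun s => (t - s) ^ (-γ) * deriv w s) volume 0 t

theorem caputoDeriv_real (γ : ℝ) (w : ℝ → ℝ) (t : ℝ) :
    caputoDeriv γ w t = (Real.Gamma (1 - γ))⁻¹ * ∫ s in (0 : ℝ)..t, (t - s) ^ (-γ) * deriv w s := by
  simp [caputoDeriv]

theorem IsCaputoRegular.deriv_add_const_mul {w z : ℝ → ℝ} (hw : IsCaputoRegular γ T w)
    (hz : IsCaputoRegular γ T z) (c : ℝ) {s t : ℝ} (ht : t ∈ Ioo 0 T) (hs : s ∈ uIoc 0 t) :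
    (t - s) ^ (-γ) * deriv w s + c * ((t - s) ^ (-γ) * deriv z s) =
      (t - s) ^ (-γ) * deriv (fun s => w s + c * z s) s := by
  rw [uIoc_of_le ht.1.le] at hs
  have hs' : s ∈ Ioo 0 T := ⟨hs.1, hs.2.trans_lt ht.2⟩
  have h := (hw.differentiableAt s hs').hasDerivAt.add
    ((hz.differentiableAt s hs').hasDerivAt.const_mul c)
  have h' : deriv (fun s => w s + c * z s) s = deriv w s + c * deriv z s := h.deriv
  rw [h']
  ring

theorem IsCaputoRegular.add_const_mul {w z : ℝ → ℝ} (hw : IsCaputoRegular γ T w)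
    (hz : IsCaputoRegular γ T z) (c : ℝ) : IsCaputoRegular γ T (fun s => w s + c * z s) where
  continuousOn := hw.continuousOn.add (hz.continuousOn.const_mul c)
  differentiableAt t ht := (hw.differentiableAt t ht).add ((hz.differentiableAt t ht).const_mul c)
  integrable t ht := ((hw.integrable t ht).add ((hz.integrable t ht).const_mul c)).congr
    fun _ hs => hw.deriv_add_const_mul hz c ht hs

theorem caputoDeriv_add_const_mul {w z : ℝ → ℝ} (hw : IsCaputoRegular γ T w)
    (hz : IsCaputoRegular γ T z) (c : ℝ) {t : ℝ} (ht : t ∈ Ioo 0 T) :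
    caputoDeriv γ (fun s => w s + c * z s) t = caputoDeriv γ w t + c * caputoDeriv γ z t := by
  rw [caputoDeriv_real, caputoDeriv_real, caputoDeriv_real, ← intervalIntegral.integral_congr_ae
    (Filter.Eventually.of_forall fun s hs => hw.deriv_add_const_mul hz c ht hs),
    intervalIntegral.integral_add (hw.integrable t ht) ((hz.integrable t ht).const_mul c),
    intervalIntegral.integral_const_mul]
  ring

theorem IsCaputoRegular.zero : IsCaputoRegular γ T (fun _ => 0) where
  continuousOn := continuousOn_const
  differentiableAt _ _ := differentiableAt_const _
  integrable t _ := by simp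

theorem IsCaputoRegular.const_mul {w : ℝ → ℝ} (hw : IsCaputoRegular γ T w) (c : ℝ) :
    IsCaputoRegular γ T (fun s => c * w s) := by
  simpa using IsCaputoRegular.zero.add_const_mul hw c

theorem caputoDeriv_const_mul {w : ℝ → ℝ} (hw : IsCaputoRegular γ T w) (c : ℝ) {t : ℝ}
    (ht : t ∈ Ioo 0 T) : caputoDeriv γ (fun s => c * w s) t = c * caputoDeriv γ w t := by
  have h := caputoDeriv_add_const_mul IsCaputoRegular.zero hw c ht
  have h0 : caputoDeriv γ (fun _ => (0 : ℝ)) t = 0 := by simp [caputoDeriv_real]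
  simpa [h0] using h

/-- The truncated Caputo integral at a minimum, after integration by parts: the remaining integral
has a sign, and only the two boundary terms are left. -/
theorem IsCaputoRegular.integral_le_of_min (hγ₀ : 0 < γ) {w : ℝ → ℝ} (hw : IsCaputoRegular γ T w)
    {t r : ℝ} (ht : t ∈ Ioo 0 T) (hr : r ∈ Ioo 0 t) (hmin : ∀ s ∈ Icc 0 t, w t ≤ w s) :
    ∫ s in (0 : ℝ)..r, (t - s) ^ (-γ) * deriv w s ≤
      (t - r) ^ (-γ) * (w r - w t) - t ^ (-γ) * (w 0 - w t) := by
  have hpos : ∀ s ∈ uIcc 0 r, 0 < t - s := by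
    intro s hs
    rw [uIcc_of_le hr.1.le] at hs
    linarith [hs.2, hr.2]
  have hcont : ∀ q : ℝ, ContinuousOn (fun s => (t - s) ^ q) (uIcc 0 r) := fun q =>
    (continuousOn_const.sub continuousOn_id).rpow_const fun s hs => Or.inl (hpos s hs).ne'
  have hsub : uIcc 0 r ⊆ uIcc 0 t := by
    rw [uIcc_of_le hr.1.le, uIcc_of_le ht.1.le]
    exact Icc_subset_Icc_right hr.2.le
  have hint : IntervalIntegrable (deriv w) volume 0 r := by
    refine ((((hw.integrable t ht).mono_set hsub).mul_continuousOn (hcont γ))).congr fun s hs => ?_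
    have h0 := hpos s (uIoc_subset_uIcc hs)
    change (t - s) ^ (-γ) * deriv w s * (t - s) ^ γ = _
    rw [mul_right_comm, ← Real.rpow_add h0]
    simp
  have hwc : ContinuousOn (fun s => w s - w t) (uIcc 0 r) := by
    refine (hw.continuousOn.mono ?_).sub continuousOn_const
    rw [uIcc_of_le hr.1.le]
    exact Icc_subset_Icc_right (hr.2.trans ht.2).le
  have hd1 : ∀ s ∈ uIcc 0 r, HasDerivAt (fun s => (t - s) ^ (-γ)) (γ * (t - s) ^ (-γ - 1)) s := by
    intro s hs
    have h := ((hasDerivAt_id s).const_sub t).rpow_const (p := -γ) (Or.inl (hpos s hs).ne')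
    simpa using h
  have hibp := intervalIntegral.integral_mul_deriv_eq_deriv_mul_of_hasDerivAt (a := 0) (b := r)
    (hcont (-γ)) hwc (u' := fun s => γ * (t - s) ^ (-γ - 1)) (v' := deriv w)
    (fun s hs => hd1 s (Ioo_subset_Icc_self hs)) (fun s hs => by
      rw [min_eq_left hr.1.le, max_eq_right hr.1.le] at hs
      exact (hw.differentiableAt s
        ⟨hs.1, hs.2.trans (hr.2.trans ht.2)⟩).hasDerivAt.sub_const (w t))
    ((continuousOn_const.mul (hcont _)).intervalIntegrable) hint
  have hnonneg : 0 ≤ ∫ s in (0 : ℝ)..r, γ * (t - s) ^ (-γ - 1) * (w s - w t) := by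
    refine intervalIntegral.integral_nonneg hr.1.le fun s hs => ?_
    have h0 := hpos s (by rwa [uIcc_of_le hr.1.le])
    have h1 := hmin s ⟨hs.1, hs.2.trans hr.2.le⟩
    have := Real.rpow_pos_of_pos h0 (-γ - 1)
    have h2 : 0 ≤ w s - w t := by linarith
    positivity
  rw [hibp, sub_zero]
  linarith

/-- At a point where `w` attains its minimum over `[0, t]`, the Caputo derivative is bounded above
by the contribution of the initial value. -/
theorem IsCaputoRegular.caputoDeriv_le_of_min (hγ₀ : 0 < γ) (hγ₁ : γ < 1) {w : ℝ → ℝ}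
    (hw : IsCaputoRegular γ T w) {t : ℝ} (ht : t ∈ Ioo 0 T) (hmin : ∀ s ∈ Icc 0 t, w t ≤ w s) :
    caputoDeriv γ w t ≤ -((Real.Gamma (1 - γ))⁻¹ * (t ^ (-γ) * (w 0 - w t))) := by
  have hΓ : 0 < Real.Gamma (1 - γ) := Real.Gamma_pos_of_pos (by linarith)
  rw [caputoDeriv_real, ← mul_neg]
  refine mul_le_mul_of_nonneg_left ?_ (inv_pos.2 hΓ).le
  have hIoo : Ioo 0 t ∈ nhdsWithin t (Iio t) := Ioo_mem_nhdsLT ht.1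
  have hl : Filter.Tendsto (fun r => ∫ s in (0 : ℝ)..r, (t - s) ^ (-γ) * deriv w s)
      (nhdsWithin t (Iio t)) (nhds (∫ s in (0 : ℝ)..t, (t - s) ^ (-γ) * deriv w s)) := by
    have h := intervalIntegral.continuousOn_primitive_interval' (hw.integrable t ht) left_mem_uIcc
      t right_mem_uIcc
    refine h.mono_left (nhdsWithin_le_of_mem ?_)
    rw [uIcc_of_le ht.1.le]
    exact Filter.mem_of_superset hIoo Ioo_subset_Icc_self
  -- the boundary term at `r` is `(t - r) ^ (1 - γ)` times a difference quotient, so it vanishes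
  have hb : Filter.Tendsto (fun r => (t - r) ^ (-γ) * (w r - w t)) (nhdsWithin t (Iio t))
      (nhds 0) := by
    have hs := (hasDerivAt_iff_tendsto_slope.1 (hw.differentiableAt t ht).hasDerivAt).mono_left
      (nhdsWithin_mono t (fun r (hr : r < t) => hr.ne))
    have hp : Filter.Tendsto (fun r => (t - r) ^ (1 - γ)) (nhdsWithin t (Iio t)) (nhds 0) := by
      have hc : ContinuousAt (fun r => (t - r) ^ (1 - γ)) t :=
        (continuousAt_const.sub continuousAt_id).rpow_const (Or.inr (by linarith))
      have := hc.tendsto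
      rw [sub_self, Real.zero_rpow (by linarith)] at this
      exact this.mono_left nhdsWithin_le_nhds
    have h := (hp.mul hs).neg
    rw [zero_mul, neg_zero] at h
    refine h.congr' ?_
    filter_upwards [self_mem_nhdsWithin] with r hr
    have h0 : 0 < t - r := sub_pos.2 hr
    have h1 : r - t ≠ 0 := by linarith
    rw [slope_def_field, sub_eq_add_neg 1 γ, Real.rpow_add h0, Real.rpow_one]
    field_simp
    ring
  have hr := hb.sub_const (t ^ (-γ) * (w 0 - w t))
  rw [zero_sub] at hr
  refine le_of_tendsto_of_tendsto hl hr ?_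
  filter_upwards [hIoo] with r hr
  exact hw.integral_le_of_min hγ₀ ht hr hmin

/-- Comparison principle for `∂^γ w / ∂t^γ + L w ≥ 0`: at a negative minimum both terms would be
nonpositive and the first one negative. -/
theorem IsCaputoRegular.nonneg_of_supersolution (hγ₀ : 0 < γ) (hγ₁ : γ < 1) {L : ℝ} (hL : 0 ≤ L)
    {w : ℝ → ℝ} (hw : IsCaputoRegular γ T w)
    (heq : ∀ t ∈ Ioo 0 T, 0 ≤ caputoDeriv γ w t + L * w t) (h0 : 0 ≤ w 0) :
    ∀ t ∈ Icc 0 T, 0 ≤ w t := by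
  have hΓ : 0 < Real.Gamma (1 - γ) := Real.Gamma_pos_of_pos (by linarith)
  have hIoo : ∀ t ∈ Ioo 0 T, 0 ≤ w t := by
    intro t ht
    by_contra! hneg
    obtain ⟨m, hm, hmin⟩ := isCompact_Icc.exists_isMinOn (nonempty_Icc.2 ht.1.le)
      (hw.continuousOn.mono (Icc_subset_Icc_right ht.2.le))
    have hmneg : w m < 0 := (hmin (right_mem_Icc.2 ht.1.le)).trans_lt hneg
    have hm0 : 0 < m := by
      rcases hm.1.eq_or_lt with h | h
      · rw [← h] at hmneg
        linarith
      · exact h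
    have hmT : m ∈ Ioo 0 T := ⟨hm0, hm.2.trans_lt ht.2⟩
    have h1 := hw.caputoDeriv_le_of_min hγ₀ hγ₁ hmT
      fun s hs => hmin ⟨hs.1, hs.2.trans hm.2⟩
    have h2 := heq m hmT
    have h3 : 0 < (Real.Gamma (1 - γ))⁻¹ * (m ^ (-γ) * (w 0 - w m)) := by
      have := Real.rpow_pos_of_pos hm0 (-γ)
      have : 0 < w 0 - w m := by linarith
      positivity
    nlinarith
  intro t ht
  rcases ht.1.eq_or_lt with h | h
  · rwa [← h]
  have hT : 0 < T := h.trans_le ht.2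
  have hcl : t ∈ closure (Ioo 0 T) := by rwa [closure_Ioo hT.ne]
  have hc := (hw.continuousOn t ht).mono Ioo_subset_Icc_self
  have := mem_closure_iff_nhdsWithin_neBot.1 hcl
  exact ge_of_tendsto hc (Filter.mem_of_superset self_mem_nhdsWithin hIoo)

/-! ### Caputo derivative of the decay profiles -/

/-- The function `t ↦ (1 + c t ^ γ)⁻¹`. With `c` proportional to `L` it has the size of the solution
of `∂^γ w / ∂t^γ + L w = 0`, `w 0 = 1`, uniformly in `L`. -/
def decayProfile (γ c t : ℝ) : ℝ := (1 + c * t ^ γ)⁻¹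

theorem one_add_mul_rpow_pos {c t : ℝ} (hc : 0 ≤ c) (ht : 0 ≤ t) : 0 < 1 + c * t ^ γ := by
  have := Real.rpow_nonneg ht γ
  positivity

theorem decayProfile_pos {c t : ℝ} (hc : 0 ≤ c) (ht : 0 ≤ t) : 0 < decayProfile γ c t :=
  inv_pos.2 (one_add_mul_rpow_pos hc ht)

theorem decayProfile_zero (hγ₀ : 0 < γ) (c : ℝ) : decayProfile γ c 0 = 1 := by
  simp [decayProfile, Real.zero_rpow hγ₀.ne']

theorem decayProfile_anti (hγ₀ : 0 < γ) {c s t : ℝ} (hc : 0 ≤ c) (hs : 0 ≤ s) (hst : s ≤ t) :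
    decayProfile γ c t ≤ decayProfile γ c s := by
  have := Real.rpow_le_rpow hs hst hγ₀.le
  exact inv_anti₀ (one_add_mul_rpow_pos hc hs) (by gcongr)

theorem decayProfile_le_one (hγ₀ : 0 < γ) {c t : ℝ} (hc : 0 ≤ c) (ht : 0 ≤ t) :
    decayProfile γ c t ≤ 1 :=
  (decayProfile_anti hγ₀ hc le_rfl ht).trans_eq (decayProfile_zero hγ₀ c)

theorem decayProfile_half_le (hγ₀ : 0 < γ) {c t : ℝ} (hc : 0 ≤ c) (ht : 0 < t) :
    decayProfile γ c (t / 2) ≤ 2 ^ γ * decayProfile γ c t := by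
  have h2 : (1 : ℝ) ≤ 2 ^ γ := Real.one_le_rpow one_le_two hγ₀.le
  have ht2 : t ^ γ = 2 ^ γ * (t / 2) ^ γ := by
    rw [← Real.mul_rpow zero_le_two (by positivity)]
    congr 1
    ring
  have h := one_add_mul_rpow_pos (γ := γ) hc ht.le
  have h' := one_add_mul_rpow_pos (γ := γ) hc (half_pos ht).le
  rw [decayProfile, decayProfile, inv_le_iff_one_le_mul₀ h', mul_right_comm, ← div_eq_mul_inv,
    one_le_div h, ht2]
  nlinarith

theorem hasDerivAt_decayProfile {c t : ℝ} (hc : 0 ≤ c) (ht : 0 < t) :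
    HasDerivAt (decayProfile γ c) (-(c * γ * t ^ (γ - 1) * decayProfile γ c t ^ 2)) t := by
  have h := (((Real.hasDerivAt_rpow_const (p := γ) (Or.inl ht.ne')).const_mul c).const_add 1).inv
    (one_add_mul_rpow_pos hc ht.le).ne'
  refine h.congr_deriv ?_
  rw [decayProfile, inv_pow]
  ring

theorem continuousOn_decayProfile (hγ₀ : 0 < γ) {c : ℝ} (hc : 0 ≤ c) (T : ℝ) :
    ContinuousOn (decayProfile γ c) (Icc 0 T) := by
  refine ContinuousOn.inv₀ ?_ fun t ht => (one_add_mul_rpow_pos hc ht.1).ne'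
  exact continuousOn_const.add
    (continuousOn_const.mul (continuousOn_id.rpow_const fun _ _ => Or.inr hγ₀.le))

theorem intervalIntegrable_deriv_decayProfile (hγ₀ : 0 < γ) {c t : ℝ} (hc : 0 ≤ c) (ht : 0 < t) :
    IntervalIntegrable (fun s => -deriv (decayProfile γ c) s) volume 0 t := by
  refine intervalIntegral.intervalIntegrable_deriv_of_nonneg
    (g := fun s => -decayProfile γ c s) ?_ ?_ ?_
  · rw [uIcc_of_le ht.le]
    exact (continuousOn_decayProfile hγ₀ hc t).neg
  · intro s hs
    rw [min_eq_left ht.le] at hs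
    exact (hasDerivAt_decayProfile hc hs.1).differentiableAt.hasDerivAt.neg
  · intro s hs
    rw [min_eq_left ht.le] at hs
    rw [(hasDerivAt_decayProfile hc hs.1).deriv, neg_neg]
    have := Real.rpow_nonneg hs.1.le (γ - 1)
    positivity

theorem intervalIntegrable_sub_rpow_neg (hγ₁ : γ < 1) (t : ℝ) :
    IntervalIntegrable (fun s => (t - s) ^ (-γ)) volume 0 t := by
  have h := (intervalIntegral.intervalIntegrable_rpow' (a := t) (b := 0) (r := -γ)
    (by linarith)).comp_sub_left t
  simpa using h

theorem integral_sub_rpow_neg (hγ₁ : γ < 1) (t : ℝ) :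
    ∫ s in (0 : ℝ)..t, (t - s) ^ (-γ) = t ^ (1 - γ) / (1 - γ) := by
  rw [intervalIntegral.integral_comp_sub_left (fun s => s ^ (-γ)) t, sub_self, sub_zero,
    integral_rpow (Or.inl (by linarith)), neg_add_eq_sub, Real.zero_rpow (by linarith), sub_zero]

/-- The Caputo integrand of the profile has a singularity at each end of `(0, t)`. On the left half
the kernel is at most `(t / 2) ^ (-γ)`, on the right half the derivative is at most its value at
`t / 2`. -/
theorem decayProfile_integrand_le (hγ₀ : 0 < γ) (hγ₁ : γ < 1) {c s t : ℝ} (hc : 0 ≤ c)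
    (hs : s ∈ Ioo 0 t) :
    (t - s) ^ (-γ) * -deriv (decayProfile γ c) s ≤
      (t / 2) ^ (-γ) * -deriv (decayProfile γ c) s +
        c * γ * (t / 2) ^ (γ - 1) * decayProfile γ c (t / 2) ^ 2 * (t - s) ^ (-γ) := by
  have ht : 0 < t := hs.1.trans hs.2
  have hts : 0 < t - s := sub_pos.2 hs.2
  rw [(hasDerivAt_decayProfile hc hs.1).deriv, neg_neg]
  have h1 := Real.rpow_nonneg hs.1.le (γ - 1)
  have h2 := Real.rpow_nonneg hts.le (-γ)
  have h3 := Real.rpow_nonneg (half_pos ht).le (-γ)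
  have h4 := Real.rpow_nonneg (half_pos ht).le (γ - 1)
  rcases le_total s (t / 2) with h | h
  · have hk : (t - s) ^ (-γ) ≤ (t / 2) ^ (-γ) :=
      Real.rpow_le_rpow_of_nonpos (half_pos ht) (by linarith) (by linarith)
    refine le_add_of_le_of_nonneg ?_ (by positivity)
    gcongr
  · have hk : s ^ (γ - 1) ≤ (t / 2) ^ (γ - 1) :=
      Real.rpow_le_rpow_of_nonpos (half_pos ht) h (by linarith)
    have hd := decayProfile_anti hγ₀ hc (half_pos ht).le h
    have hd0 := (decayProfile_pos (γ := γ) hc hs.1.le).le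
    refine le_add_of_nonneg_of_le (by positivity) ?_
    rw [mul_comm]
    gcongr

theorem decayProfile_integrand_nonneg (hγ₀ : 0 < γ) {c s t : ℝ} (hc : 0 ≤ c) (hs : s ∈ Ioo 0 t) :
    0 ≤ (t - s) ^ (-γ) * -deriv (decayProfile γ c) s := by
  rw [(hasDerivAt_decayProfile hc hs.1).deriv, neg_neg]
  have h1 := Real.rpow_nonneg hs.1.le (γ - 1)
  have h2 := Real.rpow_nonneg (sub_pos.2 hs.2).le (-γ)
  positivity

theorem intervalIntegrable_decayProfile_majorant (hγ₀ : 0 < γ) (hγ₁ : γ < 1) {c t : ℝ} (hc : 0 ≤ c)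
    (ht : 0 < t) (K : ℝ) :
    IntervalIntegrable (fun s => (t / 2) ^ (-γ) * -deriv (decayProfile γ c) s +
      K * (t - s) ^ (-γ)) volume 0 t :=
  ((intervalIntegrable_deriv_decayProfile hγ₀ hc ht).const_mul _).add
    ((intervalIntegrable_sub_rpow_neg hγ₁ t).const_mul K)

theorem isCaputoRegular_decayProfile (hγ₀ : 0 < γ) (hγ₁ : γ < 1) {c : ℝ} (hc : 0 ≤ c) (T : ℝ) :
    IsCaputoRegular γ T (decayProfile γ c) where
  continuousOn := continuousOn_decayProfile hγ₀ hc T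
  differentiableAt t ht := (hasDerivAt_decayProfile hc ht.1).differentiableAt
  integrable t ht := by
    refine (intervalIntegrable_decayProfile_majorant hγ₀ hγ₁ hc ht.1
      (c * γ * (t / 2) ^ (γ - 1) * decayProfile γ c (t / 2) ^ 2)).mono_fun ?_ ?_
    · refine (Measurable.mul ?_ (measurable_deriv _)).aestronglyMeasurable
      exact (measurable_const.sub measurable_id).pow_const _
    · rw [uIoc_of_le ht.1.le, ← restrict_Ioo_eq_restrict_Ioc]
      filter_upwards [ae_restrict_mem measurableSet_Ioo] with s hs
      have h1 := decayProfile_integrand_le hγ₀ hγ₁ hc hs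
      have h0 := decayProfile_integrand_nonneg hγ₀ hc hs
      rw [← norm_neg, ← mul_neg, Real.norm_of_nonneg h0]
      exact h1.trans (Real.le_norm_self _)

theorem caputoDeriv_decayProfile_le (hγ₀ : 0 < γ) (hγ₁ : γ < 1) {c t : ℝ} (hc : 0 ≤ c)
    (ht : 0 < t) :
    caputoDeriv γ (decayProfile γ c) t ≤
      -((Real.Gamma (1 - γ))⁻¹ * c * decayProfile γ c t) := by
  have h := (isCaputoRegular_decayProfile hγ₀ hγ₁ hc (t + 1)).caputoDeriv_le_of_min hγ₀ hγ₁
    ⟨ht, by linarith⟩ fun s hs => decayProfile_anti hγ₀ hc hs.1 hs.2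
  refine h.trans_eq ?_
  have hp := Real.rpow_pos_of_pos ht γ
  have hq := one_add_mul_rpow_pos (γ := γ) hc ht.le
  rw [decayProfile_zero hγ₀, Real.rpow_neg ht.le, decayProfile]
  field_simp
  ring

theorem le_caputoDeriv_decayProfile (hγ₀ : 0 < γ) (hγ₁ : γ < 1) {c t : ℝ} (hc : 0 ≤ c)
    (ht : 0 < t) :
    -((Real.Gamma (1 - γ))⁻¹ * (2 / (1 - γ)) * c * decayProfile γ c t) ≤
      caputoDeriv γ (decayProfile γ c) t := by
  have hΓ : 0 < Real.Gamma (1 - γ) := Real.Gamma_pos_of_pos (by linarith)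
  have hreg := isCaputoRegular_decayProfile hγ₀ hγ₁ hc (t + 1)
  set K := c * γ * (t / 2) ^ (γ - 1) * decayProfile γ c (t / 2) ^ 2 with hK
  have hmono : -∫ s in (0 : ℝ)..t, (t - s) ^ (-γ) * deriv (decayProfile γ c) s ≤
      (t / 2) ^ (-γ) * (1 - decayProfile γ c t) + K * (t ^ (1 - γ) / (1 - γ)) := by
    have h := intervalIntegral.integral_mono_on_of_le_Ioo ht.le
      (hreg.integrable t ⟨ht, by linarith⟩).neg
      (intervalIntegrable_decayProfile_majorant hγ₀ hγ₁ hc ht K) fun s hs => by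
        have := decayProfile_integrand_le hγ₀ hγ₁ hc hs
        rwa [mul_neg] at this
    have hftc : ∫ s in (0 : ℝ)..t, deriv (decayProfile γ c) s = decayProfile γ c t - 1 := by
      rw [intervalIntegral.integral_eq_sub_of_hasDerivAt_of_le ht.le
        (continuousOn_decayProfile hγ₀ hc t)
        (fun s hs => (hasDerivAt_decayProfile hc hs.1).differentiableAt.hasDerivAt)
        (by simpa using (intervalIntegrable_deriv_decayProfile hγ₀ hc ht).const_mul (-1)),
        decayProfile_zero hγ₀]
    rw [intervalIntegral.integral_add
      ((intervalIntegrable_deriv_decayProfile hγ₀ hc ht).const_mul _)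
      ((intervalIntegrable_sub_rpow_neg hγ₁ t).const_mul K),
      intervalIntegral.integral_const_mul, intervalIntegral.integral_const_mul,
      intervalIntegral.integral_neg, hftc, integral_sub_rpow_neg hγ₁] at h
    rw [← intervalIntegral.integral_neg]
    refine h.trans_eq ?_
    ring
  have hψ := decayProfile_pos (γ := γ) hc ht.le
  have hψ2 := decayProfile_pos (γ := γ) hc (half_pos ht).le
  have hhalf := decayProfile_half_le hγ₀ hc ht
  have h2p : (0 : ℝ) < 2 ^ γ := Real.rpow_pos_of_pos two_pos γ
  have htp := Real.rpow_pos_of_pos ht γ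
  have h1 : (t / 2) ^ (-γ) * (1 - decayProfile γ c t) = 2 ^ γ * c * decayProfile γ c t := by
    have hq := one_add_mul_rpow_pos (γ := γ) hc ht.le
    rw [Real.rpow_neg (by positivity), Real.div_rpow ht.le zero_le_two, decayProfile]
    field_simp
    ring
  have h2 : K * (t ^ (1 - γ) / (1 - γ)) ≤ c * (2 * γ / (1 - γ)) * decayProfile γ c t := by
    have he : (t / 2) ^ (γ - 1) * t ^ (1 - γ) = 2 / 2 ^ γ := by
      rw [Real.div_rpow ht.le zero_le_two, div_mul_eq_mul_div, ← Real.rpow_add ht]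
      rw [Real.rpow_sub two_pos, Real.rpow_one]
      simp
    have hsq : decayProfile γ c (t / 2) ^ 2 ≤ 2 ^ γ * decayProfile γ c t := by
      have := decayProfile_le_one hγ₀ hc (half_pos ht).le
      nlinarith
    calc K * (t ^ (1 - γ) / (1 - γ))
        = c * γ / (1 - γ) * ((t / 2) ^ (γ - 1) * t ^ (1 - γ)) * decayProfile γ c (t / 2) ^ 2 := by
          rw [hK]
          ring
      _ ≤ c * γ / (1 - γ) * (2 / 2 ^ γ) * (2 ^ γ * decayProfile γ c t) := by
          rw [he]
          have : 0 < 1 - γ := by linarith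
          gcongr
      _ = c * (2 * γ / (1 - γ)) * decayProfile γ c t := by
          field_simp
  have h22 : (2 : ℝ) ^ γ ≤ 2 := by
    simpa using Real.rpow_le_rpow_of_exponent_le one_le_two hγ₁.le
  have h3 : 2 ^ γ * c * decayProfile γ c t ≤ 2 * c * decayProfile γ c t := by gcongr
  have h4 : 2 * c * decayProfile γ c t + c * (2 * γ / (1 - γ)) * decayProfile γ c t =
      2 / (1 - γ) * c * decayProfile γ c t := by
    have : 1 - γ ≠ 0 := by linarith
    field_simp
    ring
  rw [caputoDeriv_real, mul_assoc, mul_assoc, ← mul_neg]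
  refine mul_le_mul_of_nonneg_left ?_ (inv_pos.2 hΓ).le
  linarith

/-! ### Scalar solutions -/

/-- Solutions on `(0, T)` of the scalar equation `∂^γ w / ∂t^γ + L w = 0`. -/
structure IsModeSolution (γ T L : ℝ) (w : ℝ → ℝ) : Prop extends IsCaputoRegular γ T w where
  equation : ∀ t ∈ Ioo 0 T, caputoDeriv γ w t + L * w t = 0

theorem IsModeSolution.const_mul {L : ℝ} {w : ℝ → ℝ} (hw : IsModeSolution γ T L w) (c : ℝ) :
    IsModeSolution γ T L (fun s => c * w s) where
  toIsCaputoRegular := hw.toIsCaputoRegular.const_mul c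
  equation t ht := by
    rw [caputoDeriv_const_mul hw.toIsCaputoRegular c ht]
    linear_combination c * hw.equation t ht

/-- The factor `Γ(1 - γ)`: the profile with coefficient `lowerRate γ * L` is a subsolution for the
rate `L`. -/
def lowerRate (γ : ℝ) : ℝ := Real.Gamma (1 - γ)

/-- The factor `Γ(1 - γ) (1 - γ) / 4`, chosen such that the profile `ψ` with coefficient
`upperRate γ * L` satisfies `∂^γ ψ / ∂t^γ + (L / 2) ψ ≥ 0`: it is a supersolution for the rate `L`
with half of the rate to spare. -/
def upperRate (γ : ℝ) : ℝ := Real.Gamma (1 - γ) * (1 - γ) / 4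

theorem lowerRate_pos (hγ₁ : γ < 1) : 0 < lowerRate γ := Real.Gamma_pos_of_pos (by linarith)

theorem upperRate_pos (hγ₁ : γ < 1) : 0 < upperRate γ := by
  have := lowerRate_pos hγ₁
  have h : 0 < 1 - γ := by linarith
  unfold lowerRate at this
  unfold upperRate
  positivity

theorem lowerRate_eq (hγ₁ : γ < 1) : lowerRate γ = 4 / (1 - γ) * upperRate γ := by
  have h : 1 - γ ≠ 0 := by linarith
  unfold lowerRate upperRate
  field_simp

theorem caputoDeriv_lowerProfile_le (hγ₀ : 0 < γ) (hγ₁ : γ < 1) {L t : ℝ} (hL : 0 ≤ L)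
    (ht : 0 < t) :
    caputoDeriv γ (decayProfile γ (lowerRate γ * L)) t ≤
      -(L * decayProfile γ (lowerRate γ * L) t) := by
  have hM := lowerRate_pos hγ₁
  refine (caputoDeriv_decayProfile_le hγ₀ hγ₁ (mul_nonneg hM.le hL) ht).trans_eq ?_
  change -((lowerRate γ)⁻¹ * _ * _) = _
  field_simp

theorem le_caputoDeriv_upperProfile (hγ₀ : 0 < γ) (hγ₁ : γ < 1) {L t : ℝ} (hL : 0 ≤ L)
    (ht : 0 < t) :
    -(L / 2 * decayProfile γ (upperRate γ * L) t) ≤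
      caputoDeriv γ (decayProfile γ (upperRate γ * L)) t := by
  refine Eq.trans_le ?_
    (le_caputoDeriv_decayProfile hγ₀ hγ₁ (mul_nonneg (upperRate_pos hγ₁).le hL) ht)
  have hM := lowerRate_pos hγ₁
  have h : 1 - γ ≠ 0 := by linarith
  unfold lowerRate at hM
  have hu : (Real.Gamma (1 - γ))⁻¹ * (2 / (1 - γ)) * (upperRate γ * L) = L / 2 := by
    unfold upperRate
    field_simp
    ring
  rw [hu]

theorem IsModeSolution.lowerProfile_le (hγ₀ : 0 < γ) (hγ₁ : γ < 1) {L : ℝ} (hL : 0 ≤ L)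
    {w : ℝ → ℝ} (hw : IsModeSolution γ T L w) (h0 : 0 ≤ w 0) {t : ℝ} (ht : t ∈ Icc 0 T) :
    w 0 * decayProfile γ (lowerRate γ * L) t ≤ w t := by
  have hc : 0 ≤ lowerRate γ * L := mul_nonneg (lowerRate_pos hγ₁).le hL
  have hψ := isCaputoRegular_decayProfile hγ₀ hγ₁ hc T
  have h := (hw.toIsCaputoRegular.add_const_mul hψ (-w 0)).nonneg_of_supersolution hγ₀ hγ₁ hL
    (fun s hs => by
      rw [caputoDeriv_add_const_mul hw.toIsCaputoRegular hψ _ hs]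
      have h1 := hw.equation s hs
      have h2 := mul_le_mul_of_nonneg_left (caputoDeriv_lowerProfile_le hγ₀ hγ₁ hL hs.1) h0
      linarith)
    (by simp [decayProfile_zero hγ₀]) t ht
  linarith

theorem IsModeSolution.le_upperProfile (hγ₀ : 0 < γ) (hγ₁ : γ < 1) {L : ℝ} (hL : 0 ≤ L)
    {w : ℝ → ℝ} (hw : IsModeSolution γ T L w) (h0 : 0 ≤ w 0) {t : ℝ} (ht : t ∈ Icc 0 T) :
    w t ≤ w 0 * decayProfile γ (upperRate γ * L) t := by
  have hc : 0 ≤ upperRate γ * L := mul_nonneg (upperRate_pos hγ₁).le hL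
  have hψ := isCaputoRegular_decayProfile hγ₀ hγ₁ hc T
  have hψ' := hψ.const_mul (w 0)
  have h := (hψ'.add_const_mul hw.toIsCaputoRegular (-1)).nonneg_of_supersolution hγ₀ hγ₁ hL
    (fun s hs => by
      rw [caputoDeriv_add_const_mul hψ' hw.toIsCaputoRegular _ hs, caputoDeriv_const_mul hψ _ hs]
      have h1 := hw.equation s hs
      have h2 := mul_le_mul_of_nonneg_left (le_caputoDeriv_upperProfile hγ₀ hγ₁ hL hs.1) h0
      have h3 := mul_nonneg (mul_nonneg h0 hL) (decayProfile_pos (γ := γ) hc hs.1.le).le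
      linarith)
    (by simp [decayProfile_zero hγ₀]) t ht
  linarith

theorem IsModeSolution.abs_mul_lowerProfile_le (hγ₀ : 0 < γ) (hγ₁ : γ < 1) {L : ℝ} (hL : 0 ≤ L)
    {w : ℝ → ℝ} (hw : IsModeSolution γ T L w) {t : ℝ} (ht : t ∈ Icc 0 T) :
    |w 0| * decayProfile γ (lowerRate γ * L) t ≤ |w t| := by
  rcases le_total 0 (w 0) with h | h
  · rw [abs_of_nonneg h]
    exact (hw.lowerProfile_le hγ₀ hγ₁ hL h ht).trans (le_abs_self _)
  · have := (hw.const_mul (-1)).lowerProfile_le hγ₀ hγ₁ hL (by linarith) ht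
    rw [abs_of_nonpos h]
    refine le_trans ?_ (neg_le_abs _)
    linarith

theorem IsModeSolution.abs_le_upperProfile (hγ₀ : 0 < γ) (hγ₁ : γ < 1) {L : ℝ} (hL : 0 ≤ L)
    {w : ℝ → ℝ} (hw : IsModeSolution γ T L w) {t : ℝ} (ht : t ∈ Icc 0 T) :
    |w t| ≤ |w 0| * decayProfile γ (upperRate γ * L) t := by
  have hψ := decayProfile_pos (γ := γ) (mul_nonneg (lowerRate_pos hγ₁).le hL) ht.1
  rcases le_total 0 (w 0) with h | h
  · have h1 := hw.lowerProfile_le hγ₀ hγ₁ hL h ht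
    rw [abs_of_nonneg h, abs_of_nonneg (le_trans (by positivity) h1)]
    exact hw.le_upperProfile hγ₀ hγ₁ hL h ht
  · have h1 := (hw.const_mul (-1)).lowerProfile_le hγ₀ hγ₁ hL (by linarith) ht
    have h2 := (hw.const_mul (-1)).le_upperProfile hγ₀ hγ₁ hL (by linarith) ht
    have h3 : 0 ≤ -1 * w 0 * decayProfile γ (lowerRate γ * L) t :=
      mul_nonneg (by linarith) hψ.le
    rw [abs_of_nonpos h, abs_of_nonpos (by linarith)]
    linarith

/-- Two solutions with the same nonnegative initial value and the rates `Lv ≤ Lu`. The difference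
`w = v - u` solves `∂^γ w / ∂t^γ + Lu w = (Lu - Lv) v`, and `v` lies below the upper profile `ψ` of
the rate `Lv`; since `∂^γ ψ / ∂t^γ + (Lv / 2) ψ ≥ 0`, the multiple `2 (Lu - Lv) / Lu ψ` is a
supersolution of this equation. -/
theorem IsModeSolution.sub_mem_Icc (hγ₀ : 0 < γ) (hγ₁ : γ < 1) {Lu Lv : ℝ} (hLv : 0 ≤ Lv)
    (hLu : 0 < Lu) (hle : Lv ≤ Lu) {u v : ℝ → ℝ} (hu : IsModeSolution γ T Lu u)
    (hv : IsModeSolution γ T Lv v) (huv : u 0 = v 0) (h0 : 0 ≤ v 0) {t : ℝ} (ht : t ∈ Icc 0 T) :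
    v t - u t ∈
      Icc 0 (2 * ((Lu - Lv) / Lu) * v 0 * decayProfile γ (upperRate γ * Lv) t) := by
  have hc : 0 ≤ upperRate γ * Lv := mul_nonneg (upperRate_pos hγ₁).le hLv
  have hψ := isCaputoRegular_decayProfile hγ₀ hγ₁ hc T
  have hw := hv.toIsCaputoRegular.add_const_mul hu.toIsCaputoRegular (-1)
  have hD : ∀ s ∈ Ioo 0 T, caputoDeriv γ (fun s => v s + -1 * u s) s +
      Lu * (v s + -1 * u s) = (Lu - Lv) * v s := by
    intro s hs
    rw [caputoDeriv_add_const_mul hv.toIsCaputoRegular hu.toIsCaputoRegular _ hs]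
    linear_combination hv.equation s hs - hu.equation s hs
  have hv0 : ∀ s ∈ Icc 0 T, 0 ≤ v s := fun s hs => le_trans
    (mul_nonneg h0 (decayProfile_pos (mul_nonneg (lowerRate_pos hγ₁).le hLv) hs.1).le)
    (hv.lowerProfile_le hγ₀ hγ₁ hLv h0 hs)
  have h1 := hw.nonneg_of_supersolution hγ₀ hγ₁ hLu.le (fun s hs => by
    rw [hD s hs]
    exact mul_nonneg (by linarith) (hv0 s (Ioo_subset_Icc_self hs))) (by simp [huv]) t ht
  have hK : 0 ≤ 2 * ((Lu - Lv) / Lu) * v 0 := by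
    have : 0 ≤ Lu - Lv := by linarith
    positivity
  have hψ' := hψ.const_mul (2 * ((Lu - Lv) / Lu) * v 0)
  have h2 := (hψ'.add_const_mul hw (-1)).nonneg_of_supersolution hγ₀ hγ₁ hLu.le (fun s hs => by
    rw [caputoDeriv_add_const_mul hψ' hw _ hs, caputoDeriv_const_mul hψ _ hs]
    have e1 := hD s hs
    have e2 := mul_le_mul_of_nonneg_left (le_caputoDeriv_upperProfile hγ₀ hγ₁ hLv hs.1) hK
    have e3 := mul_le_mul_of_nonneg_left
      (hv.le_upperProfile hγ₀ hγ₁ hLv h0 (Ioo_subset_Icc_self hs)) (sub_nonneg.2 hle)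
    have hp := decayProfile_pos (γ := γ) hc hs.1.le
    set ψ := decayProfile γ (upperRate γ * Lv) s
    have e4 : (Lu - Lv) * (v 0 * ψ) ≤ 2 * ((Lu - Lv) / Lu) * v 0 * ((Lu - Lv / 2) * ψ) := by
      have : 2 * ((Lu - Lv) / Lu) * v 0 * ((Lu - Lv / 2) * ψ) =
          (Lu - Lv) * (v 0 * ψ) + (Lu - Lv) * (v 0 * ψ) * ((Lu - Lv) / Lu) := by
        field_simp
        ring
      rw [this]
      have : 0 ≤ Lu - Lv := by linarith
      have : 0 ≤ (Lu - Lv) * (v 0 * ψ) * ((Lu - Lv) / Lu) := by positivity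
      linarith
    linarith) (by simpa [huv, decayProfile_zero hγ₀] using hK) t ht
  exact ⟨by linarith, by linarith⟩

theorem IsModeSolution.abs_sub_le (hγ₀ : 0 < γ) (hγ₁ : γ < 1) {Lu Lv : ℝ} (hLv : 0 ≤ Lv)
    (hLu : 0 < Lu) (hle : Lv ≤ Lu) {u v : ℝ → ℝ} (hu : IsModeSolution γ T Lu u)
    (hv : IsModeSolution γ T Lv v) (huv : u 0 = v 0) {t : ℝ} (ht : t ∈ Icc 0 T) :
    |v t - u t| ≤ 2 * ((Lu - Lv) / Lu) * |v 0| * decayProfile γ (upperRate γ * Lv) t := by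
  rcases le_total 0 (v 0) with h | h
  · have := hu.sub_mem_Icc hγ₀ hγ₁ hLv hLu hle hv huv h ht
    rw [abs_of_nonneg this.1, abs_of_nonneg h]
    exact this.2
  · have := (hu.const_mul (-1)).sub_mem_Icc hγ₀ hγ₁ hLv hLu hle (hv.const_mul (-1))
      (by simp [huv]) (by linarith) ht
    rw [abs_of_nonpos (by linarith [this.1]), abs_of_nonpos h]
    linarith [this.2]

/-- The effect on the initial value of a change of the final value from `u T` to `v T` and of the
rate from `Lu` to `Lv ≤ Lu`. -/
theorem IsModeSolution.abs_initial_sub_le (hγ₀ : 0 < γ) (hγ₁ : γ < 1) (hT : 0 < T) {Lu Lv : ℝ}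
    (hLv : 0 ≤ Lv) (hLu : 0 < Lu) (hle : Lv ≤ Lu) {u v : ℝ → ℝ} (hu : IsModeSolution γ T Lu u)
    (hv : IsModeSolution γ T Lv v) :
    |u 0 - v 0| ≤ (1 + lowerRate γ * T ^ γ * Lv) * |v T - u T| +
      8 / (1 - γ) * (((Lu - Lv) / Lu) * |u 0|) := by
  have hM := lowerRate_pos hγ₁
  have hm := upperRate_pos hγ₁
  have hMm := lowerRate_eq hγ₁
  have hX := Real.rpow_pos_of_pos hT γ
  have hTm : T ∈ Icc 0 T := right_mem_Icc.2 hT.le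
  have hg : 0 < 1 - γ := by linarith
  have hδ : 0 ≤ Lu - Lv := by linarith
  have hκ : 1 ≤ 4 / (1 - γ) := by
    rw [one_le_div hg]
    linarith
  set κ := 4 / (1 - γ) with hκ_def
  have h8 : 8 / (1 - γ) = 2 * κ := by
    rw [hκ_def]
    ring
  rw [h8]
  have hvl := hv.abs_mul_lowerProfile_le hγ₀ hγ₁ hLv hTm
  have hq : 0 < 1 + lowerRate γ * Lv * T ^ γ := by positivity
  by_cases h0 : v 0 = 0
  -- then `v` vanishes, and the two bounds for `u T` in terms of `u 0` suffice
  · have hvT : v T = 0 := by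
      have := hv.abs_le_upperProfile hγ₀ hγ₁ hLv hTm
      rw [h0, abs_zero, zero_mul] at this
      exact abs_nonpos_iff.1 this
    have h1 := hu.abs_mul_lowerProfile_le hγ₀ hγ₁ hLu.le hTm
    have h2 := hu.abs_le_upperProfile hγ₀ hγ₁ hLu.le hTm
    have hq1 : 0 < 1 + lowerRate γ * Lu * T ^ γ := by positivity
    have hq2 : 0 < 1 + upperRate γ * Lu * T ^ γ := by positivity
    rw [decayProfile, ← div_eq_mul_inv, div_le_iff₀ hq1] at h1
    rw [decayProfile, ← div_eq_mul_inv, le_div_iff₀ hq2] at h2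
    rw [h0, hvT, sub_zero, zero_sub, abs_neg]
    have h3 : lowerRate γ * T ^ γ * (Lu - Lv) * |u T| ≤ 2 * κ * ((Lu - Lv) / Lu * |u 0|) := by
      have h4 : upperRate γ * Lu * T ^ γ * |u T| ≤ |u 0| := by nlinarith [abs_nonneg (u T)]
      calc lowerRate γ * T ^ γ * (Lu - Lv) * |u T|
          = κ * ((Lu - Lv) / Lu * (upperRate γ * Lu * T ^ γ * |u T|)) := by
            rw [hMm]
            field_simp
        _ ≤ 2 * κ * ((Lu - Lv) / Lu * |u 0|) := by
            have hκ0 : 0 ≤ κ := by linarith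
            gcongr
            linarith
    nlinarith
  · have hr : |v 0 / v T| ≤ 1 + lowerRate γ * Lv * T ^ γ := by
      rw [decayProfile, ← div_eq_mul_inv, div_le_iff₀ hq] at hvl
      have hvT : 0 < |v T| := by
        by_contra! hn
        have := abs_pos.2 h0
        have := mul_nonpos_of_nonpos_of_nonneg hn hq.le
        linarith
      rw [abs_div, div_le_iff₀ hvT]
      linarith
    have hvT : v T ≠ 0 := by
      intro hn
      rw [hn, abs_zero] at hvl
      have := mul_pos (abs_pos.2 h0) (decayProfile_pos (γ := γ) (mul_nonneg hM.le hLv) hT.le)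
      linarith
    -- scaled to the initial value of `u`, the solution `v` differs from `u` only in the rate
    have h1 := hu.abs_sub_le hγ₀ hγ₁ hLv hLu hle (hv.const_mul (u 0 / v 0))
      (by field_simp) hTm
    have e0 : u 0 / v 0 * v 0 = u 0 := by field_simp
    rw [e0] at h1
    have hsplit : u 0 - v 0 =
        (u 0 / v 0 * v T - u T) * (v 0 / v T) - (v T - u T) * (v 0 / v T) := by
      field_simp
      ring
    have hψ : decayProfile γ (upperRate γ * Lv) T * (1 + lowerRate γ * Lv * T ^ γ) ≤ κ := by
      have hq2 : 0 < 1 + upperRate γ * Lv * T ^ γ := by positivity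
      rw [decayProfile, ← div_eq_inv_mul, div_le_iff₀ hq2, hMm]
      nlinarith
    have hψ0 := (decayProfile_pos (γ := γ) (mul_nonneg hm.le hLv) hT.le).le
    calc |u 0 - v 0|
        ≤ |u 0 / v 0 * v T - u T| * |v 0 / v T| + |v T - u T| * |v 0 / v T| := by
          rw [hsplit, ← abs_mul, ← abs_mul]
          exact abs_sub _ _
      _ ≤ (2 * ((Lu - Lv) / Lu) * |u 0| * decayProfile γ (upperRate γ * Lv) T) *
            (1 + lowerRate γ * Lv * T ^ γ) +
            |v T - u T| * (1 + lowerRate γ * Lv * T ^ γ) := by gcongr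
      _ = 2 * ((Lu - Lv) / Lu) * |u 0| * (decayProfile γ (upperRate γ * Lv) T *
            (1 + lowerRate γ * Lv * T ^ γ)) +
            |v T - u T| * (1 + lowerRate γ * Lv * T ^ γ) := by ring
      _ ≤ 2 * ((Lu - Lv) / Lu) * |u 0| * κ +
            |v T - u T| * (1 + lowerRate γ * Lv * T ^ γ) := by gcongr
      _ = _ := by ring

/-! ### Coefficients of solutions -/

/-- The coefficient along an eigenvector `e` of a symmetric `L` solves a scalar equation. Symmetry
enters only as the stated identity, so that unbounded and bounded operators are both covered. -/
theorem IsSolution.isModeSolution [CompleteSpace H] {L : H →ₗ.[ℝ] H} {u : ℝ → H} {e : H} {l : ℝ}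
    (hu : IsSolution γ T L u) (hL : ∀ x : L.domain, ⟪L x, e⟫_ℝ = l * ⟪(x : H), e⟫_ℝ) :
    IsModeSolution γ T l (fun t => ⟪u t, e⟫_ℝ) := by
  have hd : ∀ s ∈ Ioo 0 T, HasDerivAt (fun t => ⟪u t, e⟫_ℝ) ⟪deriv u s, e⟫_ℝ s := by
    intro s hs
    have h := ((hu.contDiffOn.differentiableOn one_ne_zero).differentiableAt
      (Ioo_mem_nhds hs.1 hs.2)).hasDerivAt
    simpa using h.inner ℝ (hasDerivAt_const s e)
  have hcongr : ∀ t ∈ Ioo 0 T, ∀ s ∈ uIoc 0 t, innerSL ℝ e ((t - s) ^ (-γ) • deriv u s) =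
      (t - s) ^ (-γ) * deriv (fun t => ⟪u t, e⟫_ℝ) s := by
    intro t ht s hs
    rw [uIoc_of_le ht.1.le] at hs
    rw [(hd s ⟨hs.1, hs.2.trans_lt ht.2⟩).deriv, innerSL_apply_apply, real_inner_smul_right,
      real_inner_comm]
  refine ⟨⟨?_, fun s hs => (hd s hs).differentiableAt, ?_⟩, ?_⟩
  · exact hu.continuousOn.inner continuousOn_const
  · intro t ht
    have hi := (hu.integrable t ht)
    refine IntervalIntegrable.congr (hcongr t ht) ?_
    exact ⟨(innerSL ℝ e).integrable_comp hi.1, (innerSL ℝ e).integrable_comp hi.2⟩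
  · intro t ht
    obtain ⟨hdom, heq⟩ := hu.equation t ht
    rw [caputoDeriv_real, ← intervalIntegral.integral_congr_ae
      (Filter.Eventually.of_forall fun s hs => hcongr t ht s hs),
      ContinuousLinearMap.intervalIntegral_comp_comm _ (hu.integrable t ht), innerSL_apply_apply]
    have h := congrArg (fun x => ⟪x, e⟫_ℝ) heq
    simp only [inner_add_left, inner_zero_left, hL, caputoDeriv, real_inner_smul_left] at h
    rw [real_inner_comm]
    exact h

theorem IsEigenSystem.inner_apply [CompleteSpace H] {A : H →ₗ.[ℝ] H} {φ : HilbertBasis ℕ ℝ H}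
    {lam : ℕ → ℝ} (hA : IsEigenSystem A φ lam) (n : ℕ) (v : A.domain) :
    ⟪A v, φ n⟫_ℝ = lam n * ⟪(v : H), φ n⟫_ℝ := by
  obtain ⟨hn, he⟩ := hA.eigen n
  have h := A.adjoint_isFormalAdjoint hA.selfAdjoint.dense_domain
  rw [LinearPMap.isSelfAdjoint_def.1 hA.selfAdjoint] at h
  have h1 := h v ⟨φ n, hn⟩
  rw [he, real_inner_smul_right] at h1
  exact h1

theorem inner_regularizedOp_apply (φ : HilbertBasis ℕ ℝ H) (lam : ℕ → ℝ) (b α : ℝ) (n : ℕ)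
    (v : (regularizedOp φ lam b α).domain) :
    ⟪regularizedOp φ lam b α v, φ n⟫_ℝ = lam n / (1 + α * lam n ^ b) * ⟪(v : H), φ n⟫_ℝ :=
  spectralSum_coeff φ _ (v : H) v.2 n

theorem hasSum_inner_sq (φ : HilbertBasis ℕ ℝ H) (v : H) :
    HasSum (fun n => ⟪v, φ n⟫_ℝ ^ 2) (‖v‖ ^ 2) := by
  rw [← real_inner_self_eq_norm_sq]
  refine (φ.hasSum_inner_mul_inner v v).congr_fun fun n => ?_
  rw [real_inner_comm v (φ n), sq]

/-! ### The residual `I - B_α` and the choice of `α` -/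

/-- The multiplier `α l ^ b / (1 + α l ^ b)` of `I - B_α` at the eigenvalue `l`. -/
def residualWeight (b α l : ℝ) : ℝ := α * l ^ b / (1 + α * l ^ b)

theorem residualWeight_nonneg {b α l : ℝ} (hα : 0 ≤ α) (hl : 0 < l) :
    0 ≤ residualWeight b α l := by
  have := Real.rpow_pos_of_pos hl b
  unfold residualWeight
  positivity

theorem residualWeight_eq_one_sub {b α l : ℝ} (hα : 0 ≤ α) (hl : 0 < l) :
    residualWeight b α l = 1 - 1 / (1 + α * l ^ b) := by
  have := Real.rpow_pos_of_pos hl b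
  have h : 1 + α * l ^ b ≠ 0 := by positivity
  unfold residualWeight
  field_simp
  ring

theorem residualWeight_le_one {b α l : ℝ} (hα : 0 ≤ α) (hl : 0 < l) :
    residualWeight b α l ≤ 1 := by
  have := Real.rpow_pos_of_pos hl b
  rw [residualWeight_eq_one_sub hα hl]
  have : 0 ≤ 1 / (1 + α * l ^ b) := by positivity
  linarith

theorem residualWeight_lt {b α β l : ℝ} (hα : 0 ≤ α) (hαβ : α < β) (hl : 0 < l) :
    residualWeight b α l < residualWeight b β l := by
  have := Real.rpow_pos_of_pos hl b
  rw [residualWeight_eq_one_sub hα hl, residualWeight_eq_one_sub (hα.trans hαβ.le) hl]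
  refine sub_lt_sub_left (one_div_lt_one_div_of_lt (by positivity) ?_) 1
  gcongr

theorem sub_div_eq_residualWeight {b α l : ℝ} (hα : 0 ≤ α) (hl : 0 < l) :
    (l - l / (1 + α * l ^ b)) / l = residualWeight b α l := by
  rw [residualWeight_eq_one_sub hα hl, sub_div, div_self hl.ne', div_right_comm, div_self hl.ne']

section Residual
variable {φ : HilbertBasis ℕ ℝ H} {lam : ℕ → ℝ} {b α : ℝ}

theorem inner_resolventOp_sub (hlam : ∀ n, 0 < lam n) (hα : 0 ≤ α) (f : H) (n : ℕ) :
    ⟪resolventOp φ lam b α f - f, φ n⟫_ℝ = -(residualWeight b α (lam n) * ⟪f, φ n⟫_ℝ) := by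
  rw [inner_sub_left, resolventOp, spectralSum_coeff, residualWeight_eq_one_sub hα (hlam n)]
  · ring
  · refine summable_of_bounded φ _ 1 (fun n => ?_) f
    have := Real.rpow_pos_of_pos (hlam n) b
    rw [abs_of_nonneg (by positivity), div_le_one (by positivity)]
    have : 0 ≤ α * lam n ^ b := by positivity
    linarith

theorem hasSum_resolventOp_sub (hlam : ∀ n, 0 < lam n) (hα : 0 ≤ α) (f : H) :
    HasSum (fun n => (residualWeight b α (lam n) * ⟪f, φ n⟫_ℝ) ^ 2)
      (‖resolventOp φ lam b α f - f‖ ^ 2) := by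
  refine (hasSum_inner_sq φ _).congr_fun fun n => ?_
  rw [inner_resolventOp_sub hlam hα, neg_sq]

theorem norm_resolventOp_sub_le (hlam : ∀ n, 0 < lam n) (hα : 0 ≤ α) (f : H) :
    ‖resolventOp φ lam b α f - f‖ ≤ ‖f‖ := by
  refine abs_le_of_sq_le_sq' ?_ (norm_nonneg _) |>.2
  refine hasSum_le (fun n => ?_) (hasSum_resolventOp_sub hlam hα f) (hasSum_inner_sq φ f)
  rw [mul_pow]
  have h1 := residualWeight_le_one (b := b) hα (hlam n)
  have h0 := residualWeight_nonneg (b := b) hα (hlam n)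
  exact mul_le_of_le_one_left (sq_nonneg _) (pow_le_one₀ h0 h1)

theorem norm_resolventOp_sub_sub_le (hlam : ∀ n, 0 < lam n) (hα : 0 ≤ α) (f g : H) :
    ‖(resolventOp φ lam b α f - f) - (resolventOp φ lam b α g - g)‖ ≤ ‖f - g‖ := by
  have h : (resolventOp φ lam b α f - f) - (resolventOp φ lam b α g - g) =
      resolventOp φ lam b α (f - g) - (f - g) := by
    refine ext_coeff φ fun n => ?_
    rw [inner_sub_left, inner_resolventOp_sub hlam hα, inner_resolventOp_sub hlam hα,
      inner_resolventOp_sub hlam hα, inner_sub_left]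
    ring
  rw [h]
  exact norm_resolventOp_sub_le hlam hα _

theorem norm_resolventOp_sub_lt (hlam : ∀ n, 0 < lam n) {β : ℝ} (hα : 0 ≤ α) (hαβ : α < β) {f : H}
    (hf : f ≠ 0) :
    ‖resolventOp φ lam b α f - f‖ < ‖resolventOp φ lam b β f - f‖ := by
  refine lt_of_pow_lt_pow_left₀ 2 (norm_nonneg _) ?_
  obtain ⟨k, hk⟩ : ∃ k, ⟪f, φ k⟫_ℝ ≠ 0 := by
    by_contra! h
    exact hf (ext_coeff φ fun n => by rw [h n, inner_zero_left])
  have hmono : ∀ n, residualWeight b α (lam n) ^ 2 < residualWeight b β (lam n) ^ 2 := fun n =>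
    pow_lt_pow_left₀ (residualWeight_lt hα hαβ (hlam n)) (residualWeight_nonneg hα (hlam n))
      two_ne_zero
  refine hasSum_lt (i := k) (fun n => ?_) ?_ (hasSum_resolventOp_sub hlam hα f)
    (hasSum_resolventOp_sub hlam (hα.trans hαβ.le) f)
  · simp only [mul_pow]
    exact mul_le_mul_of_nonneg_right (hmono n).le (sq_nonneg _)
  · simp only [mul_pow]
    exact mul_lt_mul_of_pos_right (hmono k) (by positivity)

theorem norm_residual_coeff_le (hlam : ∀ n, 0 < lam n) (hα : 0 ≤ α) (f : H) (n : ℕ) :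
    ‖(residualWeight b α (lam n) * ⟪f, φ n⟫_ℝ) ^ 2‖ ≤ ⟪f, φ n⟫_ℝ ^ 2 := by
  rw [Real.norm_of_nonneg (sq_nonneg _), mul_pow]
  exact mul_le_of_le_one_left (sq_nonneg _)
    (pow_le_one₀ (residualWeight_nonneg hα (hlam n)) (residualWeight_le_one hα (hlam n)))

theorem continuousOn_tsum_residual (hlam : ∀ n, 0 < lam n) (f : H) :
    ContinuousOn (fun α => ∑' n, (residualWeight b α (lam n) * ⟪f, φ n⟫_ℝ) ^ 2) (Ici 0) := by
  refine continuousOn_tsum (fun n => ?_) (summable_inner_sq φ f)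
    fun n α hα => norm_residual_coeff_le hlam hα f n
  refine (ContinuousOn.mul ?_ continuousOn_const).pow 2
  refine ContinuousOn.div (by fun_prop) (by fun_prop) fun α hα => ?_
  have := Real.rpow_pos_of_pos (hlam n) b
  have h0 : (0 : ℝ) ≤ α := hα
  positivity

theorem tendsto_tsum_residual (hlam : ∀ n, 0 < lam n) (f : H) :
    Filter.Tendsto (fun α => ∑' n, (residualWeight b α (lam n) * ⟪f, φ n⟫_ℝ) ^ 2) Filter.atTop
      (nhds (‖f‖ ^ 2)) := by
  rw [← (hasSum_inner_sq φ f).tsum_eq]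
  refine tendsto_tsum_of_dominated_convergence (summable_inner_sq φ f) (fun n => ?_) ?_
  · have hl := Real.rpow_pos_of_pos (hlam n) b
    have h1 : Filter.Tendsto (fun α => residualWeight b α (lam n)) Filter.atTop (nhds 1) := by
      have h2 : Filter.Tendsto (fun α : ℝ => 1 - 1 / (1 + α * lam n ^ b)) Filter.atTop
          (nhds (1 - 0)) := by
        refine Filter.Tendsto.const_sub 1 (Filter.Tendsto.const_div_atTop ?_ 1)
        exact Filter.tendsto_atTop_add_const_left _ _ (Filter.tendsto_id.atTop_mul_const hl)
      rw [sub_zero] at h2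
      refine h2.congr' ?_
      filter_upwards [Filter.eventually_ge_atTop 0] with α hα
      exact (residualWeight_eq_one_sub hα (hlam n)).symm
    simpa using (h1.mul_const ⟪f, φ n⟫_ℝ).pow 2
  · filter_upwards [Filter.eventually_ge_atTop 0] with α hα n
    exact norm_residual_coeff_le hlam hα f n

/-- Morozov's discrepancy principle: the residual increases strictly and continuously in `α`, from
`0` to `‖f‖`. -/
theorem existsUnique_norm_resolventOp_sub_eq (hlam : ∀ n, 0 < lam n) {f : H} {r : ℝ} (hr : 0 < r)
    (hrf : r < ‖f‖) : ∃! α : ℝ, 0 < α ∧ ‖resolventOp φ lam b α f - f‖ = r := by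
  have hf : f ≠ 0 := norm_pos_iff.1 (hr.trans hrf)
  set F : ℝ → ℝ := fun α => ∑' n, (residualWeight b α (lam n) * ⟪f, φ n⟫_ℝ) ^ 2 with hF
  have hFeq : ∀ α, 0 ≤ α → F α = ‖resolventOp φ lam b α f - f‖ ^ 2 := fun α hα =>
    (hasSum_resolventOp_sub hlam hα f).tsum_eq
  have hF0 : F 0 = 0 := by simp [hF, residualWeight]
  have hlim : Filter.Tendsto F Filter.atTop (nhds (‖f‖ ^ 2)) := tendsto_tsum_residual hlam f
  obtain ⟨X, hX, hX0⟩ := ((hlim.eventually_const_lt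
    (pow_lt_pow_left₀ hrf hr.le two_ne_zero)).and (Filter.eventually_ge_atTop 0)).exists
  obtain ⟨α, hα, hαr⟩ := intermediate_value_Icc hX0
    ((continuousOn_tsum_residual hlam f).mono Icc_subset_Ici_self)
    (show r ^ 2 ∈ Icc (F 0) (F X) from ⟨by rw [hF0]; positivity, hX.le⟩)
  have hαr' : F α = r ^ 2 := hαr
  have hα0 : 0 < α := by
    rcases hα.1.eq_or_lt with h | h
    · rw [← h, hF0] at hαr'
      have : 0 < r ^ 2 := by positivity
      linarith
    · exact h
  have hαeq : ‖resolventOp φ lam b α f - f‖ = r := by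
    rw [hFeq α hα0.le] at hαr'
    exact (pow_left_inj₀ (norm_nonneg _) hr.le two_ne_zero).1 hαr'
  refine ⟨α, ⟨hα0, hαeq⟩, ?_⟩
  rintro β ⟨hβ0, hβ⟩
  rcases lt_trichotomy β α with h | h | h
  · have := norm_resolventOp_sub_lt (b := b) (φ := φ) hlam hβ0.le h hf
    linarith
  · exact h
  · have := norm_resolventOp_sub_lt (b := b) (φ := φ) hlam hα0.le h hf
    linarith

end Residual

/-! ### Bounds for the multipliers -/

theorem rpow_le_one_add {y s : ℝ} (hy : 0 < y) (hs₀ : 0 ≤ s) (hs₁ : s ≤ 1) : y ^ s ≤ 1 + y := by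
  rcases le_total y 1 with h | h
  · have := Real.rpow_le_one hy.le h hs₀
    linarith
  · have := Real.rpow_le_rpow_of_exponent_le h hs₁
    rw [Real.rpow_one] at this
    linarith

/-- The rates of the regularized equation are bounded in terms of `α`. -/
theorem div_one_add_le_rpow {b α l : ℝ} (hb : 1 < b) (hα : 0 < α) (hl : 0 < l) :
    l / (1 + α * l ^ b) ≤ α ^ (-(1 / b)) := by
  have hlb := Real.rpow_pos_of_pos hl b
  have hy : 0 < α * l ^ b := by positivity
  have hb0 : 0 < b := by linarith
  have h := rpow_le_one_add hy (s := 1 / b) (by positivity) ((div_le_one hb0).2 hb.le)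
  rw [Real.mul_rpow hα.le hlb.le, ← Real.rpow_mul hl.le, mul_one_div_cancel hb0.ne',
    Real.rpow_one] at h
  rw [div_le_iff₀ (by positivity), Real.rpow_neg hα.le]
  have := Real.rpow_pos_of_pos hα (1 / b)
  rw [← div_eq_inv_mul, le_div_iff₀ this]
  linarith

theorem residualWeight_mul_rpow_le {b α l q : ℝ} (hb : 0 < b) (hα : 0 < α) (hl : 0 < l)
    (hq₀ : 0 ≤ q) (hq : q ≤ b) : residualWeight b α l * l ^ (-q) ≤ α ^ (q / b) := by
  have hlb := Real.rpow_pos_of_pos hl b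
  have hy : 0 < α * l ^ b := by positivity
  have hqb : q / b ≤ 1 := (div_le_one hb).2 hq
  have h := rpow_le_one_add hy (s := 1 - q / b) (by linarith)
    (by linarith [div_nonneg hq₀ hb.le])
  have he : α ^ (q / b) * (α * l ^ b) ^ (1 - q / b) = α * l ^ b * l ^ (-q) := by
    have e1 : b * (1 - q / b) = b + -q := by
      field_simp
      ring
    rw [Real.mul_rpow hα.le hlb.le, ← mul_assoc, ← Real.rpow_add hα, ← Real.rpow_mul hl.le, e1,
      Real.rpow_add hl, add_sub_cancel, Real.rpow_one, mul_assoc]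
  unfold residualWeight
  rw [div_mul_eq_mul_div, div_le_iff₀ (by positivity), ← he]
  have := Real.rpow_pos_of_pos hα (q / b)
  gcongr

theorem residualWeight_mul_rpow_le_of_le {b α l l₁ q : ℝ} (hα : 0 < α) (hl₁ : 0 < l₁)
    (hl : l₁ ≤ l) (hq : b ≤ q) : residualWeight b α l * l ^ (-q) ≤ l₁ ^ (b - q) * α := by
  have hl0 : 0 < l := hl₁.trans_le hl
  have hlb := Real.rpow_pos_of_pos hl0 b
  have hlq := Real.rpow_pos_of_pos hl0 (-q)
  have h1 : residualWeight b α l ≤ α * l ^ b := div_le_self (by positivity) (by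
    have : 0 ≤ α * l ^ b := by positivity
    linarith)
  have h2 : l ^ (b - q) ≤ l₁ ^ (b - q) := Real.rpow_le_rpow_of_nonpos hl₁ hl (by linarith)
  calc residualWeight b α l * l ^ (-q) ≤ α * l ^ b * l ^ (-q) := by gcongr
    _ = l ^ (b - q) * α := by
      rw [sub_eq_add_neg, Real.rpow_add hl0]
      ring
    _ ≤ _ := by gcongr

theorem residualWeight_mul_rpow_le_const {b α l l₁ q : ℝ} (hα : 0 < α) (hl₁ : 0 < l₁)
    (hl : l₁ ≤ l) (hq : 0 ≤ q) : residualWeight b α l * l ^ (-q) ≤ l₁ ^ (-q) := by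
  have hl0 : 0 < l := hl₁.trans_le hl
  have h1 := residualWeight_le_one (b := b) hα.le hl0
  have h2 : l ^ (-q) ≤ l₁ ^ (-q) := Real.rpow_le_rpow_of_nonpos hl₁ hl (by linarith)
  have h3 := Real.rpow_pos_of_pos hl0 (-q)
  nlinarith

/-- A bound `ε ≤ D α ^ (q / b) N` turned into a bound for `α ^ (-1 / b) ε`. -/
theorem rpow_neg_mul_le {b q α ε D N : ℝ} (hq : 0 < q) (hα : 0 < α) (hε : 0 < ε)
    (hD : 0 ≤ D) (hN : 0 ≤ N) (h : ε ≤ D * α ^ (q / b) * N) :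
    α ^ (-(1 / b)) * ε ≤ D ^ (1 / q) * (ε ^ (1 - 1 / q) * N ^ (1 / q)) := by
  have hαb := Real.rpow_pos_of_pos hα (1 / b)
  have hαq := Real.rpow_pos_of_pos hα (q / b)
  have h1 : ε ^ (1 / q) ≤ D ^ (1 / q) * α ^ (1 / b) * N ^ (1 / q) := by
    refine (Real.rpow_le_rpow hε.le h (by positivity)).trans_eq ?_
    rw [Real.mul_rpow (by positivity) hN, Real.mul_rpow hD hαq.le, ← Real.rpow_mul hα.le]
    congr 3
    field_simp
  have h2 : ε = ε ^ (1 - 1 / q) * ε ^ (1 / q) := by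
    rw [← Real.rpow_add hε, sub_add_cancel, Real.rpow_one]
  have h3 := Real.rpow_pos_of_pos hε (1 - 1 / q)
  calc α ^ (-(1 / b)) * ε = (α ^ (1 / b))⁻¹ * (ε ^ (1 - 1 / q) * ε ^ (1 / q)) := by
        rw [← h2, Real.rpow_neg hα.le]
    _ ≤ (α ^ (1 / b))⁻¹ * (ε ^ (1 - 1 / q) * (D ^ (1 / q) * α ^ (1 / b) * N ^ (1 / q))) := by
        gcongr
    _ = _ := by field_simp

/-! ### Sums over the modes -/

theorem norm_le_of_abs_inner_le (φ : HilbertBasis ℕ ℝ H) {x y z : H} {B C : ℝ} (hB : 0 ≤ B)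
    (hC : 0 ≤ C)
    (h : ∀ n, |⟪x, φ n⟫_ℝ| ≤ B * |⟪y, φ n⟫_ℝ| + C * |⟪z, φ n⟫_ℝ|) :
    ‖x‖ ≤ 2 * (B * ‖y‖ + C * ‖z‖) := by
  have hBy : 0 ≤ B * ‖y‖ := by positivity
  have hCz : 0 ≤ C * ‖z‖ := by positivity
  have hsq : ‖x‖ ^ 2 ≤ 2 * B ^ 2 * ‖y‖ ^ 2 + 2 * C ^ 2 * ‖z‖ ^ 2 := by
    refine hasSum_le (fun n => ?_) (hasSum_inner_sq φ x)
      (((hasSum_inner_sq φ y).mul_left _).add ((hasSum_inner_sq φ z).mul_left _))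
    rw [← sq_abs ⟪x, φ n⟫_ℝ, ← sq_abs ⟪y, φ n⟫_ℝ, ← sq_abs ⟪z, φ n⟫_ℝ]
    have h1 := pow_le_pow_left₀ (abs_nonneg _) (h n) 2
    nlinarith [sq_nonneg (B * |⟪y, φ n⟫_ℝ| - C * |⟪z, φ n⟫_ℝ|)]
  refine abs_le_of_sq_le_sq' ?_ (by positivity) |>.2
  nlinarith

section Interpolation
variable {φ : HilbertBasis ℕ ℝ H} {lam : ℕ → ℝ} {b α p : ℝ}

theorem hasSum_powNorm_sq (hlam : ∀ n, 0 < lam n) {x : H} (hx : x ∈ powDomain φ lam p) :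
    HasSum (fun n => (lam n ^ p * ⟪x, φ n⟫_ℝ) ^ 2) (powNorm φ lam p x ^ 2) := by
  have h0 : 0 ≤ ∑' n, lam n ^ (2 * p) * ⟪x, φ n⟫_ℝ ^ 2 := tsum_nonneg fun n => by
    have := Real.rpow_pos_of_pos (hlam n) (2 * p)
    positivity
  rw [powNorm, Real.sq_sqrt h0]
  have hs : Summable fun n => lam n ^ (2 * p) * ⟪x, φ n⟫_ℝ ^ 2 := hx
  refine hs.hasSum.congr_fun fun n => ?_
  rw [mul_pow, mul_comm 2 p, Real.rpow_mul (hlam n).le, Real.rpow_two]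

/-- If the residual multiplier times `lam ^ (-(p + 1))` is at most `S`, then the residual of `y` is
at most `S` times the `p`-norm of `x`, for `y` one order smoother than `x`. -/
theorem norm_residual_le_powNorm (hlam : ∀ n, 0 < lam n) (hα : 0 ≤ α) {x y : H}
    (hx : x ∈ powDomain φ lam p) {D S : ℝ} (hD : 0 ≤ D)
    (hyx : ∀ n, |⟪y, φ n⟫_ℝ| ≤ D * (lam n)⁻¹ * |⟪x, φ n⟫_ℝ|)
    (hS : ∀ n, residualWeight b α (lam n) * lam n ^ (-(p + 1)) ≤ S) :
    ‖resolventOp φ lam b α y - y‖ ≤ D * S * powNorm φ lam p x := by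
  have hw := fun n => residualWeight_nonneg (b := b) hα (hlam n)
  have hS0 : 0 ≤ S :=
    (mul_nonneg (hw 0) (Real.rpow_pos_of_pos (hlam 0) _).le).trans (hS 0)
  have hN : 0 ≤ powNorm φ lam p x := Real.sqrt_nonneg _
  refine abs_le_of_sq_le_sq' ?_ (by positivity) |>.2
  rw [mul_pow]
  refine hasSum_le (fun n => ?_) (hasSum_resolventOp_sub hlam hα y)
    ((hasSum_powNorm_sq hlam hx).mul_left _)
  rw [← mul_pow, sq_le_sq, abs_mul, abs_of_nonneg (hw n), abs_mul,
    abs_of_nonneg (mul_nonneg hD hS0), abs_mul, abs_of_pos (Real.rpow_pos_of_pos (hlam n) p)]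
  have hp := Real.rpow_pos_of_pos (hlam n) p
  have he : (lam n)⁻¹ = lam n ^ (-(p + 1)) * lam n ^ p := by
    rw [← Real.rpow_add (hlam n), ← Real.rpow_neg_one]
    congr 1
    ring
  calc residualWeight b α (lam n) * |⟪y, φ n⟫_ℝ|
      ≤ residualWeight b α (lam n) * (D * (lam n)⁻¹ * |⟪x, φ n⟫_ℝ|) :=
        mul_le_mul_of_nonneg_left (hyx n) (hw n)
    _ = D * (residualWeight b α (lam n) * lam n ^ (-(p + 1))) *
          (lam n ^ p * |⟪x, φ n⟫_ℝ|) := by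
        rw [he]
        ring
    _ ≤ D * S * (lam n ^ p * |⟪x, φ n⟫_ℝ|) := by
        gcongr
        exact hS n

/-- Interpolation between the `p`-norm of `x` and the residual of `y`, for `y` at most one order
smoother than `x`: modes with eigenvalue at least `R` are controlled by the former, the others
by the latter, and `R = (N / e) ^ (1 / (p + 1))` balances the two. -/
theorem norm_residual_le_interpolation (hlam : ∀ n, 0 < lam n) (hα : 0 ≤ α) (hp : 0 < p)
    {x y : H} (hx : x ∈ powDomain φ lam p) {K τ e : ℝ} (hK : 0 ≤ K) (hτ : 0 ≤ τ) (he : 0 < e)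
    (hN : 0 < powNorm φ lam p x)
    (hxy : ∀ n, |⟪x, φ n⟫_ℝ| ≤ K * lam n * |⟪y, φ n⟫_ℝ|)
    (hy : ‖resolventOp φ lam b α y - y‖ ≤ τ * e) :
    ‖resolventOp φ lam b α x - x‖ ≤
      (1 + K * τ) * (e ^ (p / (p + 1)) * powNorm φ lam p x ^ (1 / (p + 1))) := by
  set N := powNorm φ lam p x with hN_def
  set E := e ^ (p / (p + 1)) * N ^ (1 / (p + 1)) with hE
  set R := (N / e) ^ (1 / (p + 1)) with hR
  have hR0 : 0 < R := Real.rpow_pos_of_pos (by positivity) _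
  have hE0 : 0 < E := by positivity
  have hp1 : p + 1 ≠ 0 := by positivity
  have hep : e ^ (p / (p + 1)) * e ^ (1 / (p + 1)) = e := by
    rw [← Real.rpow_add he, ← add_div, div_self hp1, Real.rpow_one]
  have hNp : N ^ (p / (p + 1)) * N ^ (1 / (p + 1)) = N := by
    rw [← Real.rpow_add hN, ← add_div, div_self hp1, Real.rpow_one]
  have hRe : R * e = E := by
    rw [hR, hE, Real.div_rpow hN.le he.le, div_mul_eq_mul_div, div_eq_iff (by positivity)]
    linear_combination -N ^ (1 / (p + 1)) * hep
  have hRN : R ^ (-p) * N = E := by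
    have : R ^ p = N ^ (p / (p + 1)) / e ^ (p / (p + 1)) := by
      rw [hR, ← Real.rpow_mul (by positivity), one_div_mul_eq_div, Real.div_rpow hN.le he.le]
    rw [Real.rpow_neg hR0.le, this, inv_div, div_mul_eq_mul_div, div_eq_iff (by positivity), hE]
    linear_combination -e ^ (p / (p + 1)) * hNp
  have hsq : ‖resolventOp φ lam b α x - x‖ ^ 2 ≤ (R ^ (-p)) ^ 2 * N ^ 2 +
      (R * K) ^ 2 * ‖resolventOp φ lam b α y - y‖ ^ 2 := by
    refine hasSum_le (fun n => ?_) (hasSum_resolventOp_sub hlam hα x)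
      (((hasSum_powNorm_sq hlam hx).mul_left _).add
        ((hasSum_resolventOp_sub hlam hα y).mul_left _))
    have hw := residualWeight_nonneg (b := b) hα (hlam n)
    have hw1 := residualWeight_le_one (b := b) hα (hlam n)
    rw [← mul_pow, ← mul_pow]
    rcases le_total R (lam n) with h | h
    · refine le_add_of_le_of_nonneg (sq_le_sq.2 ?_) (sq_nonneg _)
      have h1 : 1 ≤ R ^ (-p) * lam n ^ p := by
        rw [Real.rpow_neg hR0.le, ← div_eq_inv_mul, one_le_div (Real.rpow_pos_of_pos hR0 p)]
        exact Real.rpow_le_rpow hR0.le h hp.le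
      rw [← mul_assoc, abs_mul, abs_of_nonneg hw, abs_mul (_ * _),
        abs_of_nonneg (zero_le_one.trans h1)]
      exact mul_le_mul_of_nonneg_right (hw1.trans h1) (abs_nonneg _)
    · refine le_add_of_nonneg_of_le (sq_nonneg _) (sq_le_sq.2 ?_)
      rw [abs_mul, abs_of_nonneg hw, abs_mul (R * K), abs_of_nonneg (mul_nonneg hR0.le hK),
        abs_mul, abs_of_nonneg hw]
      calc residualWeight b α (lam n) * |⟪x, φ n⟫_ℝ|
          ≤ residualWeight b α (lam n) * (K * R * |⟪y, φ n⟫_ℝ|) := by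
            refine mul_le_mul_of_nonneg_left ((hxy n).trans ?_) hw
            gcongr
        _ = R * K * (residualWeight b α (lam n) * |⟪y, φ n⟫_ℝ|) := by ring
  refine abs_le_of_sq_le_sq' ?_ (by positivity) |>.2
  have hy2 := pow_le_pow_left₀ (norm_nonneg _) hy 2
  have h1 : (R * K) ^ 2 * ‖resolventOp φ lam b α y - y‖ ^ 2 ≤ (K * τ * E) ^ 2 := by
    calc (R * K) ^ 2 * ‖resolventOp φ lam b α y - y‖ ^ 2 ≤ (R * K) ^ 2 * (τ * e) ^ 2 := by gcongr
      _ = (K * τ * (R * e)) ^ 2 := by ring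
      _ = _ := by rw [hRe]
  rw [← mul_pow, hRN] at hsq
  have h2 : 0 ≤ K * τ * E * E := by positivity
  nlinarith

end Interpolation

theorem IsModeSolution.abs_final_le (hγ₀ : 0 < γ) (hγ₁ : γ < 1) (hT : 0 < T) {L : ℝ} (hL : 0 < L)
    {w : ℝ → ℝ} (hw : IsModeSolution γ T L w) :
    |w T| ≤ (upperRate γ * T ^ γ)⁻¹ * L⁻¹ * |w 0| := by
  have hm := upperRate_pos hγ₁
  have hX := Real.rpow_pos_of_pos hT γ
  have h := hw.abs_le_upperProfile hγ₀ hγ₁ hL.le (right_mem_Icc.2 hT.le)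
  have hq : 0 < upperRate γ * L * T ^ γ := by positivity
  refine h.trans ?_
  rw [mul_comm, ← mul_inv, mul_right_comm (upperRate γ)]
  refine mul_le_mul_of_nonneg_right ?_ (abs_nonneg _)
  exact inv_anti₀ hq (by linarith)

theorem IsModeSolution.abs_initial_le (hγ₀ : 0 < γ) (hγ₁ : γ < 1) (hT : 0 < T) {L l₁ : ℝ}
    (hl₁ : 0 < l₁) (hL : l₁ ≤ L) {w : ℝ → ℝ} (hw : IsModeSolution γ T L w) :
    |w 0| ≤ (l₁⁻¹ + lowerRate γ * T ^ γ) * L * |w T| := by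
  have hM := lowerRate_pos hγ₁
  have hX := Real.rpow_pos_of_pos hT γ
  have hL0 : 0 < L := hl₁.trans_le hL
  have h := hw.abs_mul_lowerProfile_le hγ₀ hγ₁ hL0.le (right_mem_Icc.2 hT.le)
  have hq : 0 < 1 + lowerRate γ * L * T ^ γ := by positivity
  rw [decayProfile, ← div_eq_mul_inv, div_le_iff₀ hq] at h
  refine h.trans ?_
  rw [mul_comm]
  refine mul_le_mul_of_nonneg_right ?_ (abs_nonneg _)
  have : 1 ≤ l₁⁻¹ * L := by rwa [← div_eq_inv_mul, one_le_div hl₁]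
  linarith

end FractionalSobolev

end

theorem theorem3 (γ T b τ p lam₁ : ℝ) (hγ₀ : 0 < γ) (hγ₁ : γ < 1) (hT : 0 < T) (hb : 1 < b)
    (hτ : 1 < τ) (hp : 0 < p) (hlam₁ : 0 < lam₁) :
    ∃ C : ℝ, 0 < C ∧
      ∀ (H : Type*) [NormedAddCommGroup H] [InnerProductSpace ℝ H] [CompleteSpace H]
        (A : H →ₗ.[ℝ] H) (φ : HilbertBasis ℕ ℝ H) (lam : ℕ → ℝ),
        FractionalSobolev.IsEigenSystem A φ lam → lam 0 = lam₁ →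
      ∀ (f : H) (ε : ℝ), 0 < ε → τ * ε < ‖f‖ →
        (∃! α : ℝ, 0 < α ∧ ‖FractionalSobolev.resolventOp φ lam b α f - f‖ = τ * ε) ∧
        ∀ α : ℝ, 0 < α → ‖FractionalSobolev.resolventOp φ lam b α f - f‖ = τ * ε →
          ∀ u v : ℝ → H,
            FractionalSobolev.IsSolution γ T A u → ‖u T - f‖ ≤ ε →
            u 0 ∈ FractionalSobolev.powDomain φ lam p →
            FractionalSobolev.IsSolution γ T (FractionalSobolev.regularizedOp φ lam b α) v →
            v T = f →
              (p < b - 1 →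
                ‖u 0 - v 0‖ ≤
                  C * (ε ^ (p / (p + 1)) *
                    FractionalSobolev.powNorm φ lam p (u 0) ^ (1 / (p + 1)))) ∧
              (b - 1 ≤ p →
                ‖u 0 - v 0‖ ≤
                  C * (ε ^ (p / (p + 1)) *
                      FractionalSobolev.powNorm φ lam p (u 0) ^ (1 / (p + 1)) +
                    ε ^ ((b - 1) / b) *
                      FractionalSobolev.powNorm φ lam p (u 0) ^ (1 / b))) := by
  open FractionalSobolev in
  have hm := upperRate_pos hγ₁
  have hM := lowerRate_pos hγ₁
  have hX := Real.rpow_pos_of_pos hT γ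
  have hτ1 : 0 < τ - 1 := by linarith
  have hγ1 : 0 < 1 - γ := by linarith
  have hb0 : 0 < b := by linarith
  -- With `a` and `d` the coefficients of `u` at the times `0` and `T`, `Y` is the factor of the rate
  -- in the amplification of the noise, `|d| ≤ D₀ / λ |a|` and `|a| ≤ K λ |d|`. Division of `D₀` by
  -- `τ - 1` accounts for the lower bound of the residual of `u T`.
  set Y := lowerRate γ * T ^ γ with hY
  set D₀ := (upperRate γ * T ^ γ)⁻¹ with hD₀
  set D := (τ - 1)⁻¹ * D₀ with hD
  set K := lam₁⁻¹ + Y with hK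
  have hY0 : 0 < Y := by positivity
  have hD₀0 : 0 < D₀ := by positivity
  have hD0 : 0 < D := by positivity
  have hK0 : 0 < K := by positivity
  set C₁ := (D * lam₁ ^ (-(p + 1))) ^ (1 / (p + 1)) with hC₁
  set C₂ := D ^ (1 / (p + 1)) with hC₂
  set C₃ := (D * lam₁ ^ (b - (p + 1))) ^ (1 / b) with hC₃
  set C₄ := 8 / (1 - γ) * (1 + K * (τ + 1)) with hC₄
  have hC₁0 : 0 ≤ C₁ := by positivity
  have hC₂0 : 0 ≤ C₂ := by positivity
  have hC₃0 : 0 ≤ C₃ := by positivity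
  have hC₄0 : 0 < C₄ := by positivity
  refine ⟨2 * (C₁ + Y * (C₂ + C₃) + C₄), by positivity, ?_⟩
  intro H _ _ _ A φ lam hA hlam0 f ε hε hεf
  have hlam1 : ∀ n, lam₁ ≤ lam n := fun n => hlam0 ▸ hA.mono (Nat.zero_le n)
  have hlam : ∀ n, 0 < lam n := fun n => hlam₁.trans_le (hlam1 n)
  refine ⟨existsUnique_norm_resolventOp_sub_eq hlam (by positivity) hεf, ?_⟩
  intro α hα hαf u v hu huf hu0 hv hvT
  have hun := fun n => hu.isModeSolution (hA.inner_apply n)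
  have hvn := fun n => hv.isModeSolution (inner_regularizedOp_apply φ lam b α n)
  set N := powNorm φ lam p (u 0) with hN
  have hN0 : 0 ≤ N := Real.sqrt_nonneg _
  have hp1 : 0 < p + 1 := by linarith
  have hdiff := norm_resolventOp_sub_sub_le (b := b) (φ := φ) hlam hα.le (u T) f
  have hup : ‖resolventOp φ lam b α (u T) - u T‖ ≤ (τ + 1) * ε := by
    have := norm_le_norm_add_norm_sub' (resolventOp φ lam b α (u T) - u T)
      (resolventOp φ lam b α f - f)
    linarith
  have hlow : (τ - 1) * ε ≤ ‖resolventOp φ lam b α (u T) - u T‖ := by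
    have := norm_le_norm_add_norm_sub (resolventOp φ lam b α (u T) - u T)
      (resolventOp φ lam b α f - f)
    linarith
  have hεS : ∀ S, (∀ n, residualWeight b α (lam n) * lam n ^ (-(p + 1)) ≤ S) →
      ε ≤ D * S * N := by
    intro S hS
    have h := hlow.trans (norm_residual_le_powNorm hlam hα.le hu0 hD₀0.le
      (fun n => (hun n).abs_final_le hγ₀ hγ₁ hT (hlam n)) hS)
    rw [hD, mul_assoc, mul_assoc, ← div_eq_inv_mul, le_div_iff₀ hτ1]
    linarith
  have hεN := hεS _ fun n => residualWeight_mul_rpow_le_const hα hlam₁ (hlam1 n) hp1.le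
  have hNpos : 0 < N := by
    rcases hN0.eq_or_lt with h | h
    · rw [← h, mul_zero] at hεN
      linarith
    · exact h
  have e1 : 1 - 1 / (p + 1) = p / (p + 1) := by
    field_simp
    ring
  have e2 : 1 - 1 / b = (b - 1) / b := by field_simp
  set E := ε ^ (p / (p + 1)) * N ^ (1 / (p + 1)) with hE
  set E' := ε ^ ((b - 1) / b) * N ^ (1 / b) with hE'
  have hE0 : 0 ≤ E := by positivity
  have hE'0 : 0 ≤ E' := by positivity
  have hεE : ε ≤ C₁ * E := by
    have h := rpow_neg_mul_le (b := b) (q := p + 1) (α := 1) hp1 one_pos hε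
      (D := D * lam₁ ^ (-(p + 1))) (by positivity) hN0 (by simpa using hεN)
    rwa [Real.one_rpow, one_mul, e1] at h
  have hres := norm_residual_le_interpolation hlam hα.le hp hu0 hK0.le (by linarith) hε hNpos
    (fun n => (hun n).abs_initial_le hγ₀ hγ₁ hT hlam₁ (hlam1 n)) hup
  have hmain : ‖u 0 - v 0‖ ≤ 2 * (C₁ * E + Y * (α ^ (-(1 / b)) * ε) + C₄ * E) := by
    have hαb := Real.rpow_pos_of_pos hα (-(1 / b))
    have h8 : 0 < 8 / (1 - γ) := by positivity
    have h := norm_le_of_abs_inner_le φ (x := u 0 - v 0) (y := u T - f)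
      (z := resolventOp φ lam b α (u 0) - u 0) (B := 1 + Y * α ^ (-(1 / b)))
      (C := 8 / (1 - γ)) (by positivity) h8.le fun n => by
        have hlb := Real.rpow_pos_of_pos (hlam n) b
        have hq : 1 ≤ 1 + α * lam n ^ b := by
          have : 0 ≤ α * lam n ^ b := by positivity
          linarith
        have h := (hun n).abs_initial_sub_le hγ₀ hγ₁ hT
          (div_nonneg (hlam n).le (by linarith)) (hlam n) (div_le_self (hlam n).le hq) (hvn n)
        rw [sub_div_eq_residualWeight hα.le (hlam n), hvT, ← inner_sub_left, ← inner_sub_left,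
          ← abs_neg ⟪f - u T, φ n⟫_ℝ, ← inner_neg_left, neg_sub] at h
        rw [inner_resolventOp_sub hlam hα.le, abs_neg, abs_mul,
          abs_of_nonneg (residualWeight_nonneg hα.le (hlam n))]
        refine h.trans ?_
        gcongr
        exact div_one_add_le_rpow hb hα (hlam n)
    have h1 : (1 + Y * α ^ (-(1 / b))) * ‖u T - f‖ ≤ (1 + Y * α ^ (-(1 / b))) * ε := by gcongr
    have h2 := mul_le_mul_of_nonneg_left hres h8.le
    have h3 : 8 / (1 - γ) * ((1 + K * (τ + 1)) * E) = C₄ * E := by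
      rw [hC₄]
      ring
    rw [h3] at h2
    linarith
  constructor
  · intro hpb
    have h1 := hεS _ fun n => residualWeight_mul_rpow_le hb0 hα (hlam n) hp1.le (by linarith)
    have h2 := rpow_neg_mul_le hp1 hα hε hD0.le hN0 h1
    rw [e1] at h2
    have h3 := mul_le_mul_of_nonneg_left h2 hY0.le
    have h4 : 0 ≤ Y * C₃ * E := by positivity
    linarith
  · intro hpb
    have h1 := hεS _ fun n =>
      residualWeight_mul_rpow_le_of_le (b := b) hα hlam₁ (hlam1 n) (by linarith)
    have h2 := rpow_neg_mul_le (b := b) (q := b) (D := D * lam₁ ^ (b - (p + 1))) hb0 hα hε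
      (by positivity) hN0 (by rwa [div_self hb0.ne', Real.rpow_one, mul_assoc D])
    rw [e2] at h2
    have h3 := mul_le_mul_of_nonneg_left h2 hY0.le
    have h4 : 0 ≤ Y * C₂ * E := by positivity
    have h5 : 0 ≤ Y * C₃ * E := by positivity
    have h6 : 0 ≤ (C₁ + Y * C₂ + C₄) * E' := by positivity
    linarith
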